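/- Let $K$ be a field, $S=K[x_1,\dots,x_n]$, and let $u=x_{i_1}\cdots x_{i_d}$ with $1\le i_1<\cdots<i_d\le n$ be a squarefree monomial with $u\neq x_1$. Let $I\subset S$ be the squarefree strongly stable principal ideal with Borel generator $u$, that is, $u$ is a minimal monomial generator of $I$ and $I$ is the smallest squarefree strongly stable ideal containing $u$. (A squarefree strongly stable ideal is a monomial ideal generated in a single degree by squarefree monomials such that, for every minimal monomial generator $w$ and all $i<j$ with $x_j\mid w$ and $x_i\nmid w$, the monomial $x_iw/x_j$ is again a minimal generator.) Let $A=\{k_1<\cdots<k_s\}\subsetneq\{1,\dots,n\}$, $P_A=(x_i : i\notin A)$ and $S_A=K[x_i : i\notin A]$, and let $I(P_A)\subset S_A$ be the unique monomial ideal with $I(P_A)S_{P_A}=IS_{P_A}$. Let $\mathrm{Ass}^\infty(I)$ be the set of primes that lie in $\mathrm{Ass}(S/I^k)$ for all large $k$. Then $I(P_A)$ is a squarefree strongly stable principal ideal of $S_A$ with a unique Borel generator, denoted $u_A$. Write $\min(v)$ and $\max(v)$ for the smallest and the largest index of a variable dividing a monomial $v$, with $\min(1)=+\infty$ and $\max(1)=-\infty$,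 and $\min(S_A)$, $\max(S_A)$ for the smallest and the largest element of $\{1,\dots,n\}\setminus A$. Unless $S_A=K[x_j]$ and $u_A=x_j$ for some $j$, the following are equivalent: (a) $P_A\in\mathrm{Ass}^\infty(I)$; (b) (i) $\min(u_A)>\min(S_A)$ and (ii) $\max(u_A)=\max(S_A)$. In the exceptional case $S_A=K[x_j]$, $u_A=x_j$, one has $P_A=(x_j)\in\mathrm{Ass}^\infty(I)$. Moreover, set $k_0=i_0=0$ and $k_t=n+1$ for $t>s$, and let $h=\min\{0\le j\le d : j=d \text{ or } i_{j+1}>i_j+1\}$, $f=\max\{0\le r\le s : k_r+1<k_{r+1}\}$, $g=\max\{0\le t\le d : i_t\le k_{f+1}-1\}$ and $l(t)=\min\{r : k_t\le i_r\}$, with $l(t)=d+1$ if $k_t>i_d$. Then (whether or not the exceptional case holds) (b)(i) holds if and only if $k_t=t$ for $t=0,\dots,h$, and (b)(ii) holds if and only if $i_g=k_{f+1}-1$ and $l(f-j)<g-j$ for $j=0,\dots,f-1$. -/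

import Mathlib

open MvPolynomial

namespace SquarefreeBorel

section Monomial

variable {σ K : Type*} [Field K]

/-- `I` is generated by monomials. A monomial `x^a` is represented by its exponent vector
`a : σ →₀ ℕ`. -/
def IsMonomialIdeal (I : Ideal (MvPolynomial σ K)) : Prop :=
  ∃ s : Set (σ →₀ ℕ), I = Ideal.span ((fun a => monomial a (1 : K)) '' s)

/-- `G(I)`: the exponent vectors of the monomials of `I` that are minimal under divisibility. -/
def minGens (I : Ideal (MvPolynomial σ K)) : Set (σ →₀ ℕ) :=
  {a | monomial a (1 : K) ∈ I ∧ ∀ b, b ≤ a → monomial b (1 : K) ∈ I → b = a}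

variable [LinearOrder σ]

/-- `k`-strongly stable ideals: monomial ideals generated in a single degree, all of whose minimal
generators have exponents at most `k`, and with `x_i (w / x_j) ∈ G(I)` whenever `w ∈ G(I)`,
`i < j`, `x_j` divides `w` and `deg_{x_i} w < k`. For `k = 1`: squarefree strongly stable. -/
structure IsStronglyStable (k : ℕ) (I : Ideal (MvPolynomial σ K)) : Prop where
  monomialIdeal : IsMonomialIdeal I
  singleDegree : ∃ d : ℕ, ∀ a ∈ minGens I, a.degree = d
  bounded : ∀ a ∈ minGens I, ∀ i, a i ≤ k
  exchange : ∀ a ∈ minGens I, ∀ i j, i < j → a j ≠ 0 → a i < k →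
    (a - Finsupp.single j 1) + Finsupp.single i 1 ∈ minGens I

/-- `I` is the `k`-strongly stable principal ideal with Borel generator `x^u`: the monomial `x^u`
lies in `G(I)`, and `I` is the smallest `k`-strongly stable ideal that contains `x^u`. -/
def IsBorelGenerator (k : ℕ) (I : Ideal (MvPolynomial σ K)) (u : σ →₀ ℕ) : Prop :=
  u ∈ minGens I ∧ IsLeast {J | IsStronglyStable k J ∧ monomial u (1 : K) ∈ J} I

end Monomial

section Localization

variable {σ : Type*} [DecidableEq σ] (K : Type*) [Field K]

/-- The monomial prime ideal `P_A`, generated by the variables `x_i` with `i ∉ A`. -/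
noncomputable def monomialPrime (A : Finset σ) : Ideal (MvPolynomial σ K) :=
  Ideal.span ((X : σ → MvPolynomial σ K) '' {i | i ∉ A})

/-- The substitution `x_i ↦ 0` for `i ∉ A`, whose kernel is `P_A`. -/
noncomputable def killOutside (A : Finset σ) : MvPolynomial σ K →ₐ[K] MvPolynomial σ K :=
  aeval (fun i => if i ∈ A then X i else 0)

theorem monomialPrime_eq_ker (A : Finset σ) :
    monomialPrime K A = RingHom.ker (killOutside K A) := by
  apply le_antisymm
  · rw [monomialPrime, Ideal.span_le]
    rintro _ ⟨i, hi, rfl⟩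
    have hi' : i ∉ A := hi
    simp [RingHom.mem_ker, killOutside, hi']
  · have key : ∀ p : MvPolynomial σ K, p - killOutside K A p ∈ monomialPrime K A := by
      have h : (Ideal.Quotient.mkₐ K (monomialPrime K A)).comp (killOutside K A) =
          Ideal.Quotient.mkₐ K (monomialPrime K A) := by
        apply MvPolynomial.algHom_ext
        intro i
        by_cases hi : i ∈ A
        · simp [killOutside, hi]
        · have : (X i : MvPolynomial σ K) ∈ monomialPrime K A :=
            Ideal.subset_span ⟨i, hi, rfl⟩
          simp [killOutside, hi, Ideal.Quotient.eq_zero_iff_mem.mpr this]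
      intro p
      rw [← Ideal.Quotient.eq]
      exact (DFunLike.congr_fun h p).symm
    intro p hp
    have h := key p
    rwa [RingHom.mem_ker.mp hp, sub_zero] at h

instance monomialPrime_isPrime (A : Finset σ) : (monomialPrime K A).IsPrime := by
  rw [monomialPrime_eq_ker]
  exact RingHom.ker_isPrime _

variable {K}

/-- The monomial localization `I(P_A)`, an ideal of `S_A = K[x_i : i ∉ A]`: the contraction of
`I S_{P_A}` to `S_A` along `S_A ⊆ S → S_{P_A}`. For a monomial ideal `I` this is the unique monomial
ideal `J` of `S_A` with `J S_{P_A} = I S_{P_A}`. -/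
noncomputable def monomialLocalization (I : Ideal (MvPolynomial σ K)) (A : Finset σ) :
    Ideal (MvPolynomial {i : σ // i ∉ A} K) :=
  ((I.map (algebraMap (MvPolynomial σ K) (Localization.AtPrime (monomialPrime K A)))).comap
    (algebraMap (MvPolynomial σ K) (Localization.AtPrime (monomialPrime K A)))).comap
    (rename (Subtype.val : {i : σ // i ∉ A} → σ) :
      MvPolynomial {i : σ // i ∉ A} K →ₐ[K] MvPolynomial σ K)

end Localization

/-- The stable set `Ass^∞(I)`: the primes that belong to `Ass(R / I^k)` for all large `k`. -/
def stableAss {R : Type*} [CommRing R] (I : Ideal R) : Set (Ideal R) :=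
  {P | ∀ᶠ k : ℕ in Filter.atTop, P ∈ associatedPrimes R (R ⧸ I ^ k)}

section Indices

/- The variables `x_1, …, x_n` are indexed by `Fin n`; the element `i : Fin n` stands for
`x_{i+1}`. The numbers below use the indices `1, …, n`. -/

variable {n : ℕ}

/-- For `T = {t_1 < ⋯ < t_m} ⊆ {1, …, n}`: the value `t_r` for `1 ≤ r ≤ m`, with `t_0 = 0` and
`t_r = n + 1` for `r > m`. -/
def entry (T : Finset (Fin n)) : ℕ → ℕ
  | 0 => 0
  | r + 1 => if h : r < T.card then (T.orderEmbOfFin rfl ⟨r, h⟩ : ℕ) + 1 else n + 1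

/-- `h = min {j : i_{j+1} > i_j + 1}` for the index set `{i_1 < ⋯ < i_d}`, where `i_{d+1}` is read
as `∞`; so `h` is the largest number with `i_t = t` for all `t ≤ h ≤ d`. -/
noncomputable def numH (T : Finset (Fin n)) : ℕ :=
  sInf {j | j = T.card ∨ (j < T.card ∧ entry T j + 1 < entry T (j + 1))}

/-- `f = max {r ∈ {0, …, s} : k_r + 1 < k_{r+1}}` for `A = {k_1 < ⋯ < k_s}`. -/
def numF (A : Finset (Fin n)) : ℕ :=
  ((Finset.range (A.card + 1)).filter fun r => entry A r + 1 < entry A (r + 1)).sup id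

/-- `g = max {t ∈ {0, …, d} : i_t ≤ k_{f+1} - 1}` for the index set `T = {i_1 < ⋯ < i_d}`. -/
def numG (T A : Finset (Fin n)) : ℕ :=
  ((Finset.range (T.card + 1)).filter fun t => entry T t ≤ entry A (numF A + 1) - 1).sup id

/-- `l(t) = min {r : k_t ≤ i_r}`. -/
noncomputable def numL (T A : Finset (Fin n)) (t : ℕ) : ℕ :=
  sInf {r | entry A t ≤ entry T r}

end Indices

end SquarefreeBorel

/-!
The ideal with Borel generator supported on `T` is generated by the squarefree monomials whose
supports are the bases of a matroid, and membership in it is a counting condition: `x^a ∈ I` if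
and only if every initial segment of the variables contains at least as many elements of `supp a`
as of `T` (`isBorelGenerator_iff`). Everything is translated into such counts.

*Localization.* Setting `x_i = 1` for `i ∈ A` relaxes the requirement on the segment `J` from `#(T
∩ J)` to `#(T ∩ J) - #(A ∩ J)`. The running maximum of this number grows by at most one at each
step, and only outside `A`; the places where it grows are the support of the localized generator
(`dominates_localizedSupport_iff`, `monomialLocalization_borelIdeal`). So the condition on the
minimum of the localized generator says that the running maximum does not grow at the first index
outside `A`, and the one on its maximum that it grows at the last such index.

*Powers.* `x^a ∈ I^k` if and only if `∑_{i ∈ J} min (a_i, k) ≥ k * #(T ∩ J)` for every initial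
segment `J` (`mem_borelIdeal_pow`). The nontrivial direction splits the monomial with exponents
`min (a_i, k)` and partial sums `S` into `k` squarefree factors, supported on the jumps of `⌊(S +
l) / k⌋` for `0 ≤ l < k`; Hermite's identity shows that their product is that monomial
(`DominatesPow.exists_factors`).

*Associated primes.* Exponents above `k` are irrelevant to membership in `I^k`, so `P_A` is
associated to `S / I^k` if and only if there is an `a` with `a_i ≥ k` on `A`, `x^a ∉ I^k` and `x_i
x^a ∈ I^k` for all `i ∉ A`. Then a segment violated by `a` contains all indices outside `A`, it
misses its bound by exactly one, and `a_i < k` off `A`. Comparison with the shorter segments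
yields the condition on the maximum; if an initial segment `J ⊆ T` ended in an index `p ∉ A`
before the last one, its bound would force `a_p ≥ k`, which yields the condition on the minimum
and shows why it is void if there is only one index outside `A` (`conditions_of_associated`).
Conversely, filling the variables outside `A` greedily from the front with exponents `k - 1` gives
such an `a` for every `k ≥ n` (`associated_of_conditions`).

*Indices.* The `r`-th element of a set and the counting function of the set are adjoint
(`entry_le_iff`), which turns the formulas in `h`, `f`, `g` and `l` into inequalities between
counts.
-/

namespace SquarefreeBorel

/-! ### Domination of finite sets and the ideals it defines -/

theorem exists_mem_minGens_le {σ K : Type*} [Field K] {I : Ideal (MvPolynomial σ K)} {u : σ →₀ ℕ}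
    (hu : monomial u (1 : K) ∈ I) : ∃ w ∈ minGens I, w ≤ u := by
  obtain ⟨w, hwu, hw, hmin⟩ :=
    exists_minimal_le_of_wellFoundedLT (fun a => monomial a (1 : K) ∈ I) u hu
  exact ⟨w, ⟨hw, fun b hb hbI => le_antisymm hb (hmin hbI hb)⟩, hwu⟩

section Borel

variable {σ : Type*} [LinearOrder σ]

/-- `F` dominates `T`: every initial segment `{i | i ≤ m}` contains at least as many elements of `F`
as of `T`. For sets of equal size this is the componentwise comparison of the sorted elements. -/
def Dominates (T F : Finset σ) : Prop :=
  ∀ m, (T.filter (· ≤ m)).card ≤ (F.filter (· ≤ m)).card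

/-- The exponent vector of the squarefree monomial with support `F`. -/
noncomputable def squarefreeVector (F : Finset σ) : σ →₀ ℕ :=
  Finsupp.indicator F fun _ _ => 1

theorem squarefreeVector_apply (F : Finset σ) (i : σ) :
    squarefreeVector F i = if i ∈ F then 1 else 0 := by
  simp [squarefreeVector, Finsupp.indicator_apply]

@[simp]
theorem support_squarefreeVector (F : Finset σ) : (squarefreeVector F).support = F := by
  ext i
  simp [squarefreeVector_apply]

theorem squarefreeVector_le {F : Finset σ} {a : σ →₀ ℕ} :
    squarefreeVector F ≤ a ↔ F ⊆ a.support := by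
  constructor
  · intro h i hi
    have := h i
    rw [squarefreeVector_apply, if_pos hi] at this
    rw [Finsupp.mem_support_iff]
    omega
  · intro h i
    rw [squarefreeVector_apply]
    split_ifs with hi
    · exact Nat.one_le_iff_ne_zero.mpr (Finsupp.mem_support_iff.mp (h hi))
    · exact Nat.zero_le _

theorem eq_squarefreeVector {a : σ →₀ ℕ} (h : ∀ i, a i ≤ 1) : a = squarefreeVector a.support := by
  ext i
  rw [squarefreeVector_apply]
  have := h i
  split_ifs with hi <;> rw [Finsupp.mem_support_iff] at hi <;> omega

theorem degree_squarefreeVector (F : Finset σ) : (squarefreeVector F).degree = F.card := by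
  rw [Finsupp.degree_apply, support_squarefreeVector, Finset.card_eq_sum_ones]
  exact Finset.sum_congr rfl fun i hi => by rw [squarefreeVector_apply, if_pos hi]

theorem squarefreeVector_exchange {B : Finset σ} {i j : σ} (hij : i ≠ j) (hj : j ∈ B)
    (hi : i ∉ B) : squarefreeVector B - Finsupp.single j 1 + Finsupp.single i 1 =
      squarefreeVector (insert i (B.erase j)) := by
  ext x
  simp only [Finsupp.add_apply, Finsupp.tsub_apply, squarefreeVector_apply, Finset.mem_insert,
    Finset.mem_erase, Finsupp.single_apply]
  by_cases hxi : x = i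
  · subst hxi
    simp [hi, hij.symm]
  · by_cases hxj : x = j
    · subst hxj
      simp [hj, hxi, Ne.symm hxi]
    · simp [hxi, hxj, Ne.symm hxi, Ne.symm hxj]

theorem Dominates.refl (T : Finset σ) : Dominates T T := fun _ => le_rfl

theorem Dominates.trans {T F G : Finset σ} (h : Dominates T F) (h' : Dominates F G) :
    Dominates T G := fun m => (h m).trans (h' m)

theorem dominates_of_subset {T F : Finset σ} (h : T ⊆ F) : Dominates T F := fun _ =>
  Finset.card_le_card (Finset.filter_subset_filter _ h)

theorem Dominates.card_le {T F : Finset σ} (h : Dominates T F) : T.card ≤ F.card := by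
  rcases T.eq_empty_or_nonempty with rfl | hT
  · simp
  · have h1 := h (T.max' hT)
    rw [Finset.filter_true_of_mem fun i hi => T.le_max' i hi] at h1
    exact h1.trans (Finset.card_filter_le _ _)

/-- A set that dominates `T` contains a dominating set of the size of `T`, namely its `#T` smallest
elements. -/
theorem Dominates.exists_subset {T F : Finset σ} (h : Dominates T F) :
    ∃ B ⊆ F, Dominates T B ∧ B.card = T.card := by
  induction hn : F.card generalizing F with
  | zero => exact ⟨F, subset_rfl, h, by have := h.card_le; omega⟩
  | succ n ih =>
    rcases h.card_le.eq_or_lt with he | hlt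
    · exact ⟨F, subset_rfl, h, he.symm⟩
    have hF : F.Nonempty := Finset.card_pos.mp (by omega)
    have hM := F.max'_mem hF
    have hc : (F.erase (F.max' hF)).card = n := by rw [Finset.card_erase_of_mem hM]; omega
    have hdom : Dominates T (F.erase (F.max' hF)) := by
      intro m
      by_cases hm : F.max' hF ≤ m
      · rw [Finset.filter_true_of_mem (s := F.erase _) fun i hi =>
          (F.le_max' i (Finset.mem_of_mem_erase hi)).trans hm]
        exact (Finset.card_filter_le _ _).trans (by omega)
      · rw [Finset.filter_erase, Finset.erase_eq_of_notMem (by simp [hm])]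
        exact h m
    obtain ⟨B, hB, h1, h2⟩ := ih hdom hc
    exact ⟨B, hB.trans (Finset.erase_subset _ _), h1, h2⟩

theorem dominates_exchange {B : Finset σ} {i j : σ} (hij : i < j) (hj : j ∈ B) (hi : i ∉ B) :
    Dominates B (insert i (B.erase j)) := by
  intro m
  by_cases hm : j ≤ m
  · rw [Finset.filter_insert, if_pos (hij.le.trans hm), Finset.filter_erase,
      Finset.card_insert_of_notMem (by simp [hi]), Finset.card_erase_of_mem (by simp [hj, hm])]
    omega
  · refine Finset.card_le_card fun x hx => ?_
    rw [Finset.mem_filter] at hx ⊢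
    refine ⟨Finset.mem_insert_of_mem (Finset.mem_erase.mpr ⟨?_, hx.1⟩), hx.2⟩
    rintro rfl
    exact hm hx.2

/-- Any family closed under the moves `W ↦ (W \ {j}) ∪ {i}` with `i < j` contains, with `W`, every
set of the same size that dominates `W`. The move used exchanges the smallest element of `B \ W`
for the smallest element of `W \ B`. -/
theorem mem_of_dominates {P : Finset σ → Prop}
    (hP : ∀ W i j, P W → i < j → j ∈ W → i ∉ W → P (insert i (W.erase j)))
    {W B : Finset σ} (hW : P W) (hd : Dominates W B) (hc : W.card = B.card) : P B := by
  induction hn : (W \ B).card generalizing W with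
  | zero =>
    have hs : W ⊆ B := Finset.sdiff_eq_empty_iff_subset.mp (Finset.card_eq_zero.mp hn)
    rwa [← Finset.eq_of_subset_of_card_le hs hc.ge]
  | succ n ih =>
    have hWB : (W \ B).Nonempty := Finset.card_pos.mp (by omega)
    have hBW : (B \ W).Nonempty := by
      rw [Finset.sdiff_nonempty]
      intro hs
      rw [Finset.eq_of_subset_of_card_le hs hc.le, Finset.sdiff_self] at hWB
      exact Finset.not_nonempty_empty hWB
    obtain ⟨hjW, hjB⟩ := Finset.mem_sdiff.mp ((W \ B).min'_mem hWB)
    obtain ⟨hiB, hiW⟩ := Finset.mem_sdiff.mp ((B \ W).min'_mem hBW)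
    set j := (W \ B).min' hWB with hj
    set i := (B \ W).min' hBW with hi
    have hlt : ∀ x, x < j → x ∈ W → x ∈ B := by
      intro x hx hxW
      by_contra hxB
      exact absurd ((W \ B).min'_le x (Finset.mem_sdiff.mpr ⟨hxW, hxB⟩)) (not_le.mpr hx)
    have hij : i < j := by
      by_contra hle
      have hji : j < i := lt_of_le_of_ne (not_lt.mp hle) (by rintro h; rw [h] at hjB; exact hjB hiB)
      -- otherwise `W` has one element more than `B` up to `j`
      refine absurd (hd j) (not_le.mpr (Finset.card_lt_card ?_))
      refine ⟨fun x hx => ?_, fun hs => ?_⟩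
      · rw [Finset.mem_filter] at hx ⊢
        refine ⟨?_, hx.2⟩
        by_contra hxW
        exact absurd ((B \ W).min'_le x (Finset.mem_sdiff.mpr ⟨hx.1, hxW⟩))
          (not_le.mpr (hx.2.trans_lt hji))
      · exact hjB (Finset.mem_filter.mp (hs (Finset.mem_filter.mpr ⟨hjW, le_rfl⟩))).1
    refine ih (hP W i j hW hij hjW hiW) ?_ ?_ ?_
    · intro m
      by_cases hm : j ≤ m
      · rw [Finset.filter_insert, if_pos (hij.le.trans hm), Finset.filter_erase,
          Finset.card_insert_of_notMem (by simp [hiW]), Finset.card_erase_of_mem (by simp [hjW, hm])]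
        have h1 := hd m
        have : 0 < (W.filter (· ≤ m)).card :=
          Finset.card_pos.mpr ⟨j, Finset.mem_filter.mpr ⟨hjW, hm⟩⟩
        omega
      · refine Finset.card_le_card fun x hx => ?_
        simp only [Finset.mem_filter, Finset.mem_insert, Finset.mem_erase] at hx ⊢
        rcases hx with ⟨rfl | ⟨_, hxW⟩, hxm⟩
        · exact ⟨hiB, hxm⟩
        · exact ⟨hlt x (hxm.trans_lt (not_le.mp hm)) hxW, hxm⟩
    · rw [Finset.card_insert_of_notMem (by simp [hiW]), Finset.card_erase_of_mem hjW, ← hc]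
      have := Finset.card_pos.mpr ⟨j, hjW⟩
      omega
    · rw [Finset.insert_sdiff_of_mem _ hiB, Finset.erase_sdiff_comm,
        Finset.card_erase_of_mem (Finset.mem_sdiff.mpr ⟨hjW, hjB⟩), hn]
      rfl

variable (K : Type*) [Field K]

/-- The ideal spanned by the monomials whose support dominates `T`. -/
noncomputable def borelIdeal (T : Finset σ) : Ideal (MvPolynomial σ K) :=
  Ideal.span ((fun a => monomial a (1 : K)) '' {a | Dominates T a.support})

variable {K}

theorem mem_borelIdeal {T : Finset σ} {p : MvPolynomial σ K} :
    p ∈ borelIdeal K T ↔ ∀ a ∈ p.support, Dominates T a.support := by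
  rw [borelIdeal, mem_ideal_span_monomial_image]
  refine forall₂_congr fun a _ => ⟨?_, fun h => ⟨a, h, le_rfl⟩⟩
  rintro ⟨b, hb, hba⟩
  exact Dominates.trans hb (dominates_of_subset (Finsupp.support_mono hba))

theorem monomial_mem_borelIdeal {T : Finset σ} {a : σ →₀ ℕ} :
    monomial a (1 : K) ∈ borelIdeal K T ↔ Dominates T a.support := by
  classical
  rw [mem_borelIdeal, support_monomial, if_neg one_ne_zero]
  simp

theorem mem_minGens_borelIdeal {T : Finset σ} {a : σ →₀ ℕ} :
    a ∈ minGens (borelIdeal K T) ↔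
      ∃ B, Dominates T B ∧ B.card = T.card ∧ a = squarefreeVector B := by
  constructor
  · rintro ⟨ha, hmin⟩
    obtain ⟨B, hB, hd, hc⟩ := (monomial_mem_borelIdeal.mp ha).exists_subset
    refine ⟨B, hd, hc, (hmin _ (squarefreeVector_le.mpr hB) ?_).symm⟩
    rwa [monomial_mem_borelIdeal, support_squarefreeVector]
  · rintro ⟨B, hd, hc, rfl⟩
    refine ⟨by rwa [monomial_mem_borelIdeal, support_squarefreeVector], fun b hb hmem => ?_⟩
    rw [monomial_mem_borelIdeal] at hmem
    have hs : b.support ⊆ B := by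
      simpa using Finsupp.support_mono hb
    have he : b.support = B := Finset.eq_of_subset_of_card_le hs (hc.le.trans hmem.card_le)
    exact le_antisymm hb (squarefreeVector_le.mpr he.ge)

theorem isStronglyStable_borelIdeal (T : Finset σ) : IsStronglyStable 1 (borelIdeal K T) where
  monomialIdeal := ⟨_, rfl⟩
  singleDegree := by
    refine ⟨T.card, fun a ha => ?_⟩
    obtain ⟨B, -, hc, rfl⟩ := mem_minGens_borelIdeal.mp ha
    rw [degree_squarefreeVector, hc]
  bounded := by
    intro a ha i
    obtain ⟨B, -, hc, rfl⟩ := mem_minGens_borelIdeal.mp ha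
    rw [squarefreeVector_apply]
    split_ifs <;> simp
  exchange := by
    intro a ha i j hij haj hai
    obtain ⟨B, hd, hc, rfl⟩ := mem_minGens_borelIdeal.mp ha
    have hj : j ∈ B := by
      by_contra h
      exact haj (by rw [squarefreeVector_apply, if_neg h])
    have hi : i ∉ B := by
      intro h
      rw [squarefreeVector_apply, if_pos h] at hai
      exact lt_irrefl _ hai
    refine mem_minGens_borelIdeal.mpr
      ⟨insert i (B.erase j), hd.trans (dominates_exchange hij hj hi), ?_, ?_⟩
    · have := Finset.card_pos.mpr ⟨j, hj⟩
      rw [Finset.card_insert_of_notMem (by simp [hi]), Finset.card_erase_of_mem hj, ← hc]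
      omega
    · exact squarefreeVector_exchange hij.ne hj hi

theorem borelIdeal_le {I : Ideal (MvPolynomial σ K)} (hI : IsStronglyStable 1 I) {u : σ →₀ ℕ}
    (hu : monomial u (1 : K) ∈ I) : borelIdeal K u.support ≤ I := by
  obtain ⟨w, hw, hwu⟩ := exists_mem_minGens_le hu
  rw [borelIdeal, Ideal.span_le]
  rintro _ ⟨a, ha, rfl⟩
  have hd : Dominates w.support a.support :=
    (dominates_of_subset (Finsupp.support_mono hwu)).trans ha
  obtain ⟨B, hB, hdB, hc⟩ := hd.exists_subset
  have key : squarefreeVector B ∈ minGens I := by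
    refine mem_of_dominates (P := fun W => squarefreeVector W ∈ minGens I) ?_
      (W := w.support) ?_ hdB hc.symm
    · intro W i j hW hij hj hi
      rw [← squarefreeVector_exchange hij.ne hj hi]
      exact hI.exchange _ hW i j hij (by simp [squarefreeVector_apply, hj])
        (by simp [squarefreeVector_apply, hi])
    · rwa [← eq_squarefreeVector (hI.bounded w hw)]
  have hle : squarefreeVector B ≤ a := squarefreeVector_le.mpr hB
  have hmul : monomial a (1 : K) = monomial (a - squarefreeVector B) 1 *
      monomial (squarefreeVector B) 1 := by
    rw [monomial_mul, one_mul, tsub_add_cancel_of_le hle]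
  change monomial a (1 : K) ∈ I
  rw [hmul]
  exact I.mul_mem_left _ key.1

/-- A squarefree strongly stable principal ideal consists of the polynomials all of whose monomials
have a support dominating that of the Borel generator. -/
theorem isBorelGenerator_iff {I : Ideal (MvPolynomial σ K)} {u : σ →₀ ℕ} :
    IsBorelGenerator 1 I u ↔ u = squarefreeVector u.support ∧ I = borelIdeal K u.support := by
  constructor
  · rintro ⟨hu, ⟨hI, huI⟩, hleast⟩
    refine ⟨eq_squarefreeVector (hI.bounded u hu), le_antisymm (hleast ?_) (borelIdeal_le hI huI)⟩
    exact ⟨isStronglyStable_borelIdeal _, monomial_mem_borelIdeal.mpr (Dominates.refl _)⟩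
  · rintro ⟨hu, rfl⟩
    refine ⟨mem_minGens_borelIdeal.mpr ⟨_, Dominates.refl _, rfl, hu⟩,
      ⟨isStronglyStable_borelIdeal _, monomial_mem_borelIdeal.mpr (Dominates.refl _)⟩, ?_⟩
    rintro J ⟨hJ, huJ⟩
    exact borelIdeal_le hJ huJ

theorem Dominates.antisymm {T F : Finset σ} (h : Dominates T F) (h' : Dominates F T) : T = F := by
  have hle : ∀ m, (T.filter (· ≤ m)).card = (F.filter (· ≤ m)).card := fun m =>
    le_antisymm (h m) (h' m)
  by_contra hne
  have hs : (symmDiff T F).Nonempty := by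
    rw [Finset.nonempty_iff_ne_empty]
    intro h0
    exact hne (symmDiff_eq_bot.mp h0)
  set m := (symmDiff T F).min' hs with hm
  have hlt : ∀ x < m, (x ∈ T ↔ x ∈ F) := by
    intro x hx
    have : x ∉ symmDiff T F := fun hx' => absurd ((symmDiff T F).min'_le x hx') (not_le.mpr hx)
    rw [Finset.mem_symmDiff] at this
    tauto
  have key : ∀ A B : Finset σ, (∀ x < m, (x ∈ A ↔ x ∈ B)) → m ∈ A → m ∉ B →
      (B.filter (· ≤ m)).card < (A.filter (· ≤ m)).card := by
    intro A B hAB hA hB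
    refine Finset.card_lt_card ⟨fun x hx => ?_, fun hs => ?_⟩
    · rw [Finset.mem_filter] at hx ⊢
      have hxm : x ≠ m := by rintro rfl; exact hB hx.1
      exact ⟨(hAB x (lt_of_le_of_ne hx.2 hxm)).mpr hx.1, hx.2⟩
    · exact hB (Finset.mem_filter.mp (hs (Finset.mem_filter.mpr ⟨hA, le_rfl⟩))).1
  have hmem := (symmDiff T F).min'_mem hs
  rw [← hm, Finset.mem_symmDiff] at hmem
  rcases hmem with ⟨h1, h2⟩ | ⟨h1, h2⟩
  · exact absurd (hle m) (key T F hlt h1 h2).ne'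
  · exact absurd (hle m) (key F T (fun x hx => (hlt x hx).symm) h1 h2).ne

theorem borelIdeal_injective {T F : Finset σ} (h : borelIdeal K T = borelIdeal K F) : T = F := by
  have key : ∀ {A B : Finset σ}, borelIdeal K A = borelIdeal K B → Dominates A B := by
    intro A B h
    have : monomial (squarefreeVector B) (1 : K) ∈ borelIdeal K A := by
      rw [h, monomial_mem_borelIdeal, support_squarefreeVector]
      exact Dominates.refl _
    rwa [monomial_mem_borelIdeal, support_squarefreeVector] at this
  exact (key h).antisymm (key h.symm)

theorem isBorelGenerator_borelIdeal_iff {T : Finset σ} {u : σ →₀ ℕ} :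
    IsBorelGenerator 1 (borelIdeal K T) u ↔ u = squarefreeVector T := by
  rw [isBorelGenerator_iff]
  constructor
  · rintro ⟨hu, h⟩
    rw [hu, borelIdeal_injective h]
  · rintro rfl
    simp

end Borel

/-! ### Counting along initial segments of `Fin n` -/

section HeadCount

variable {n : ℕ}

/-- The sum of the first `j` values of `c`. -/
def headSum (c : Fin n → ℕ) (j : ℕ) : ℕ :=
  ∑ i ∈ Finset.univ.filter (fun i : Fin n => (i : ℕ) < j), c i

/-- The number of elements of `T` among the first `j` elements of `Fin n`. -/
def headCount (T : Finset (Fin n)) (j : ℕ) : ℕ :=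
  (T.filter fun i : Fin n => (i : ℕ) < j).card

theorem headSum_zero (c : Fin n → ℕ) : headSum c 0 = 0 := by
  simp [headSum]

theorem headSum_succ (c : Fin n → ℕ) (i : Fin n) : headSum c (i + 1) = headSum c i + c i := by
  have : (Finset.univ.filter fun x : Fin n => (x : ℕ) < i + 1) =
      insert i (Finset.univ.filter fun x : Fin n => (x : ℕ) < i) := by
    ext x
    simp only [Finset.mem_filter, Finset.mem_univ, true_and, Finset.mem_insert, Fin.ext_iff]
    omega
  rw [headSum, this, Finset.sum_insert (by simp), add_comm, headSum]

theorem headSum_mono (c : Fin n → ℕ) : Monotone (headSum c) := fun _ _ h =>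
  Finset.sum_le_sum_of_subset fun x hx => by
    simp only [Finset.mem_filter, Finset.mem_univ, true_and] at hx ⊢
    omega

theorem headSum_le_headSum {c c' : Fin n → ℕ} (h : ∀ i, c i ≤ c' i) (j : ℕ) :
    headSum c j ≤ headSum c' j :=
  Finset.sum_le_sum fun i _ => h i

theorem headSum_add (c c' : Fin n → ℕ) (j : ℕ) :
    headSum (fun i => c i + c' i) j = headSum c j + headSum c' j :=
  Finset.sum_add_distrib

theorem headCount_eq_headSum (T : Finset (Fin n)) (j : ℕ) :
    headCount T j = headSum (fun i => if i ∈ T then 1 else 0) j := by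
  rw [headSum, Finset.sum_boole, Nat.cast_id, headCount]
  congr 1
  ext i
  simp only [Finset.mem_filter, Finset.mem_univ, true_and]
  tauto

theorem headCount_zero (T : Finset (Fin n)) : headCount T 0 = 0 := by
  simp [headCount]

theorem headCount_succ (T : Finset (Fin n)) (i : Fin n) :
    headCount T (i + 1) = headCount T i + if i ∈ T then 1 else 0 := by
  rw [headCount_eq_headSum, headSum_succ, ← headCount_eq_headSum]

theorem headCount_mono (T : Finset (Fin n)) : Monotone (headCount T) := fun _ _ h =>
  Finset.card_le_card fun x hx => by
    rw [Finset.mem_filter] at hx ⊢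
    exact ⟨hx.1, hx.2.trans_le h⟩

theorem headCount_of_le (T : Finset (Fin n)) {j : ℕ} (hj : n ≤ j) : headCount T j = T.card := by
  rw [headCount, Finset.filter_true_of_mem]
  intro i _
  omega

theorem headCount_le_card (T : Finset (Fin n)) (j : ℕ) : headCount T j ≤ T.card :=
  Finset.card_filter_le _ _

theorem headCount_union {T F : Finset (Fin n)} (h : Disjoint T F) (j : ℕ) :
    headCount (T ∪ F) j = headCount T j + headCount F j := by
  rw [headCount, Finset.filter_union, Finset.card_union_of_disjoint]
  · rfl
  · exact Finset.disjoint_filter_filter h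

/-- Induction over the initial segments of `Fin n`. -/
theorem head_induction {P : ℕ → Prop} (h0 : P 0) (hs : ∀ i : Fin n, P i → P (i + 1)) :
    ∀ j ≤ n, P j := by
  intro j
  induction j with
  | zero => exact fun _ => h0
  | succ j ih => exact fun hj => hs ⟨j, hj⟩ (ih (by omega))

theorem headCount_le (T : Finset (Fin n)) : ∀ j ≤ n, headCount T j ≤ j := by
  refine head_induction (by simp [headCount_zero]) fun i ih => ?_
  rw [headCount_succ]
  split_ifs <;> omega

theorem headCount_eq_iff (T : Finset (Fin n)) :
    ∀ j ≤ n, (headCount T j = j ↔ ∀ i : Fin n, (i : ℕ) < j → i ∈ T) := by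
  refine head_induction (by simp [headCount_zero]) fun i ih => ?_
  have hle := headCount_le T i i.2.le
  rw [headCount_succ]
  constructor
  · intro h x hx
    split_ifs at h with hi
    · rcases Nat.lt_succ_iff_lt_or_eq.mp hx with h' | h'
      · exact ih.mp (by omega) x h'
      · rwa [Fin.ext h']
    · omega
  · intro h
    rw [if_pos (h i (by omega)), ih.mpr fun x hx => h x (by omega)]

theorem headCount_le_add_sub (T : Finset (Fin n)) (j : ℕ) : ∀ m ≤ n, j ≤ m →
    headCount T m ≤ headCount T j + (m - j) := by
  refine head_induction (by simp [headCount_zero]) fun i ih hj => ?_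
  rcases hj.eq_or_lt with rfl | hlt
  · omega
  · have := ih (by omega)
    rw [headCount_succ]
    split_ifs <;> omega

theorem dominates_iff_headCount {T F : Finset (Fin n)} :
    Dominates T F ↔ ∀ j ≤ n, headCount T j ≤ headCount F j := by
  have key : ∀ (T : Finset (Fin n)) (m : Fin n),
      (T.filter (· ≤ m)).card = headCount T (m + 1) := by
    intro T m
    rw [headCount]
    congr 1
    ext i
    rw [Finset.mem_filter, Finset.mem_filter, Fin.le_def, Nat.lt_succ_iff]
  constructor
  · intro h j hj
    rcases j with _ | j
    · simp [headCount_zero]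
    · have := h ⟨j, hj⟩
      rwa [key, key] at this
  · intro h m
    rw [key, key]
    exact h _ m.2

/-- The set of places where `F` increases. -/
def jumps (n : ℕ) (F : ℕ → ℕ) : Finset (Fin n) :=
  Finset.univ.filter fun i : Fin n => F i < F (i + 1)

theorem mem_jumps {F : ℕ → ℕ} {i : Fin n} : i ∈ jumps n F ↔ F i < F (i + 1) := by
  simp [jumps]

theorem headCount_jumps {F : ℕ → ℕ} (hF : Monotone F)
    (hstep : ∀ i : Fin n, F (i + 1) ≤ F i + 1) :
    ∀ j ≤ n, headCount (jumps n F) j + F 0 = F j := by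
  refine head_induction (by simp [headCount_zero]) fun i ih => ?_
  have h1 := hF (Nat.le_succ i)
  have h2 := hstep i
  rw [headCount_succ]
  simp only [mem_jumps]
  simp only [Nat.succ_eq_add_one] at h1
  split_ifs <;> omega

end HeadCount

/-! ### Monomial localization -/

section Localize

variable {n : ℕ}

/-- The largest excess `#(T ∩ J) - #(A ∩ J)` over the initial segments `J` with at most `j`
elements. It is nonnegative because of the empty segment, so truncated subtraction is harmless. -/
def excess (T A : Finset (Fin n)) (j : ℕ) : ℕ :=
  (Finset.range (j + 1)).sup fun m => headCount T m - headCount A m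

theorem excess_succ (T A : Finset (Fin n)) (j : ℕ) :
    excess T A (j + 1) = max (excess T A j) (headCount T (j + 1) - headCount A (j + 1)) := by
  rw [excess, Finset.range_add_one, Finset.sup_insert, max_comm]
  rfl

theorem excess_zero (T A : Finset (Fin n)) : excess T A 0 = 0 := by
  simp [excess, headCount_zero]

theorem excess_mono (T A : Finset (Fin n)) : Monotone (excess T A) := fun _ _ h =>
  Finset.sup_mono fun x hx => by
    rw [Finset.mem_range] at hx ⊢
    omega

theorem sub_le_excess (T A : Finset (Fin n)) {m j : ℕ} (h : m ≤ j) :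
    headCount T m - headCount A m ≤ excess T A j :=
  Finset.le_sup (f := fun m => headCount T m - headCount A m)
    (Finset.mem_range.mpr (Nat.lt_succ_of_le h))

theorem excess_succ_le (T A : Finset (Fin n)) (i : Fin n) :
    excess T A (i + 1) ≤ excess T A i + 1 := by
  rw [excess_succ]
  have h1 := sub_le_excess T A (le_refl (i : ℕ))
  have h2 := headCount_succ T i
  have h3 := headCount_succ A i
  split_ifs at h2 h3 <;> omega

theorem excess_succ_of_mem (T A : Finset (Fin n)) {i : Fin n} (hi : i ∈ A) :
    excess T A (i + 1) = excess T A i := by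
  rw [excess_succ]
  have h1 := sub_le_excess T A (le_refl (i : ℕ))
  have h2 := headCount_succ T i
  have h3 := headCount_succ A i
  rw [if_pos hi] at h3
  split_ifs at h2 <;> omega

theorem excess_lt_excess_succ_iff (T A : Finset (Fin n)) (i : Fin n) :
    excess T A i < excess T A (i + 1) ↔
      ∀ j ≤ (i : ℕ), headCount T j + headCount A (i + 1) < headCount T (i + 1) + headCount A j := by
  rw [excess_succ, lt_max_iff, or_iff_right (lt_irrefl _)]
  constructor
  · intro h j hj
    have := sub_le_excess T A hj
    omega
  · intro h
    have h0 := h 0 (Nat.zero_le _)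
    rw [headCount_zero, headCount_zero] at h0
    refine (Finset.sup_lt_iff (by rw [bot_eq_zero]; omega)).mpr fun j hj => ?_
    have := h j (Nat.lt_succ_iff.mp (Finset.mem_range.mp hj))
    omega

/-- The support of the Borel generator of the monomial localization at `P_A`: the indices outside
`A` at which the running maximum of `#(T ∩ J) - #(A ∩ J)` increases. -/
def localizedSupport (T A : Finset (Fin n)) : Finset {i : Fin n // i ∉ A} :=
  (jumps n (excess T A)).subtype (· ∉ A)

theorem mem_localizedSupport {T A : Finset (Fin n)} {i : {i : Fin n // i ∉ A}} :
    i ∈ localizedSupport T A ↔ excess T A (i : Fin n) < excess T A ((i : Fin n) + 1) := by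
  rw [localizedSupport, Finset.mem_subtype, mem_jumps]

theorem map_localizedSupport (T A : Finset (Fin n)) :
    (localizedSupport T A).map (Function.Embedding.subtype _) = jumps n (excess T A) := by
  rw [localizedSupport, Finset.subtype_map_of_mem]
  intro i hi hiA
  rw [mem_jumps, excess_succ_of_mem T A hiA] at hi
  exact lt_irrefl _ hi

theorem card_filter_le_subtype {A : Finset (Fin n)} (F : Finset {i : Fin n // i ∉ A})
    (m : {i : Fin n // i ∉ A}) :
    (F.filter (· ≤ m)).card =
      headCount (F.map (Function.Embedding.subtype _)) ((m : Fin n) + 1) := by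
  rw [headCount, Finset.filter_map, Finset.card_map]
  congr 1
  ext i
  rw [Finset.mem_filter, Finset.mem_filter, ← Subtype.coe_le_coe, Fin.le_def, ← Nat.lt_succ_iff]
  rfl

theorem dominates_localizedSupport_iff {T A : Finset (Fin n)} {F : Finset {i : Fin n // i ∉ A}} :
    Dominates (localizedSupport T A) F ↔
      Dominates T (F.map (Function.Embedding.subtype _) ∪ A) := by
  have hdisj : Disjoint (F.map (Function.Embedding.subtype _)) A := by
    rw [Finset.disjoint_left]
    intro i hi
    obtain ⟨x, -, rfl⟩ := Finset.mem_map.mp hi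
    exact x.2
  have hJ : ∀ j ≤ n, headCount (jumps n (excess T A)) j = excess T A j := by
    intro j hj
    have := headCount_jumps (excess_mono T A) (excess_succ_le T A) j hj
    rwa [excess_zero, add_zero] at this
  set G := F.map (Function.Embedding.subtype _) with hG
  have h1 : Dominates (localizedSupport T A) F ↔ ∀ j ≤ n, excess T A j ≤ headCount G j := by
    constructor
    · intro h
      refine head_induction (by rw [excess_zero]; exact Nat.zero_le _) fun i ih => ?_
      by_cases hi : i ∈ A
      · rw [excess_succ_of_mem T A hi]
        exact ih.trans (headCount_mono G (Nat.le_succ _))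
      · have := h ⟨i, hi⟩
        rwa [card_filter_le_subtype, card_filter_le_subtype, map_localizedSupport,
          hJ _ (by exact i.2)] at this
    · intro h m
      rw [card_filter_le_subtype, card_filter_le_subtype, map_localizedSupport,
        hJ _ (m : Fin n).2]
      exact h _ (m : Fin n).2
  rw [h1, dominates_iff_headCount]
  simp only [headCount_union hdisj]
  constructor
  · intro h j hj
    have := sub_le_excess T A (le_refl j)
    have := h j hj
    omega
  · intro h j hj
    refine Finset.sup_le fun m hm => ?_
    rw [Finset.mem_range] at hm
    have h2 := h m (by omega)
    have h3 := headCount_mono G (show m ≤ j by omega)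
    omega

variable {K : Type*} [Field K]

theorem notMem_monomialPrime_iff {A : Finset (Fin n)} {p : MvPolynomial (Fin n) K} :
    p ∉ monomialPrime K A ↔ ∃ c ∈ p.support, c.support ⊆ A := by
  rw [monomialPrime, mem_ideal_span_X_image]
  push Not
  refine exists_congr fun c => and_congr_right fun _ => ⟨fun h i hi => ?_, fun h i hi => ?_⟩
  · by_contra hiA
    exact Finsupp.mem_support_iff.mp hi (h i hiA)
  · by_contra hc
    exact hi (h (Finsupp.mem_support_iff.mpr hc))

theorem rename_support_val {A : Finset (Fin n)} (p : MvPolynomial {i : Fin n // i ∉ A} K)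
    {b : Fin n →₀ ℕ} :
    b ∈ (rename (Subtype.val : {i : Fin n // i ∉ A} → Fin n) p).support ↔
      ∃ a ∈ p.support, a.mapDomain Subtype.val = b := by
  classical
  rw [support_rename_of_injective Subtype.val_injective, Finset.mem_image]

theorem support_mapDomain_val {A : Finset (Fin n)} (a : {i : Fin n // i ∉ A} →₀ ℕ) :
    (a.mapDomain Subtype.val).support = a.support.map (Function.Embedding.subtype _) := by
  rw [Finsupp.mapDomain_support_of_injective Subtype.val_injective, Finset.map_eq_image]
  rfl

/-- Setting the variables with index in `A` to `1` turns the ideal with Borel generator supported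
on `T` into the one with Borel generator supported on `localizedSupport T A`. If `s ∉ P_A`
multiplies `p` into `I`, then the product of a monomial of `s` in the variables of `A` with a minimal monomial
of `p` outside the target ideal cannot cancel in `s * p`, which contradicts `s * p ∈ I`. -/
theorem monomialLocalization_borelIdeal (T A : Finset (Fin n)) :
    monomialLocalization (borelIdeal K T) A = borelIdeal K (localizedSupport T A) := by
  classical
  ext p
  rw [monomialLocalization, Ideal.mem_comap, Ideal.mem_comap,
    IsLocalization.algebraMap_mem_map_algebraMap_iff (monomialPrime K A).primeCompl]
  constructor
  · rintro ⟨s, hs, hsp⟩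
    obtain ⟨c, hc, hcA⟩ := notMem_monomialPrime_iff.mp hs
    by_contra hp
    rw [mem_borelIdeal] at hp
    push Not at hp
    obtain ⟨a₀, ha₀, hd₀⟩ := hp
    obtain ⟨a, -, ⟨ha, hda⟩, hmin⟩ := exists_minimal_le_of_wellFoundedLT
      (fun a => a ∈ p.support ∧ ¬ Dominates (localizedSupport T A) a.support) a₀ ⟨ha₀, hd₀⟩
    have hcoeff : coeff (c + a.mapDomain Subtype.val)
        (s * rename (Subtype.val : {i : Fin n // i ∉ A} → Fin n) p) = coeff c s * coeff a p := by
      rw [coeff_mul, Finset.sum_eq_single (c, a.mapDomain Subtype.val),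
        coeff_rename_mapDomain _ Subtype.val_injective]
      · rintro ⟨c', b'⟩ hmem hne
        rw [Finset.HasAntidiagonal.mem_antidiagonal] at hmem
        dsimp only at hmem ⊢
        by_contra h0
        have hb' := (rename_support_val p).mp (mem_support_iff.mpr (right_ne_zero_of_mul h0))
        obtain ⟨a', ha', rfl⟩ := hb'
        have hle : a' ≤ a := by
          intro i
          have h1 := DFunLike.congr_fun hmem (i : Fin n)
          have h2 : c (i : Fin n) = 0 := by
            by_contra hci
            exact i.2 (hcA (Finsupp.mem_support_iff.mpr hci))
          rw [Finsupp.add_apply, Finsupp.add_apply, Finsupp.mapDomain_apply Subtype.val_injective,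
            Finsupp.mapDomain_apply Subtype.val_injective] at h1
          omega
        have hge := hmin ⟨ha', fun h =>
          hda (h.trans (dominates_of_subset (Finsupp.support_mono hle)))⟩ hle
        obtain rfl := le_antisymm hle hge
        exact hne (Prod.ext (add_right_cancel hmem) rfl)
      · intro h
        refine absurd ?_ h
        rw [Finset.HasAntidiagonal.mem_antidiagonal]
    have hmem := mem_borelIdeal.mp hsp (c + a.mapDomain Subtype.val) (by
      rw [mem_support_iff, hcoeff]
      exact mul_ne_zero (mem_support_iff.mp hc) (mem_support_iff.mp ha))
    refine hda (dominates_localizedSupport_iff.mpr (hmem.trans (dominates_of_subset ?_)))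
    refine Finsupp.support_add.trans ?_
    rw [support_mapDomain_val, Finset.union_comm]
    exact Finset.union_subset_union_right hcA
  · intro hp
    refine ⟨monomial (squarefreeVector A) 1, ?_, ?_⟩
    · refine notMem_monomialPrime_iff.mpr ⟨squarefreeVector A, ?_, ?_⟩
      · rw [support_monomial, if_neg one_ne_zero, Finset.mem_singleton]
      · rw [support_squarefreeVector]
    · rw [mem_borelIdeal]
      intro b hb
      obtain ⟨c, hc, d, hd, rfl⟩ := Finset.mem_add.mp (support_mul _ _ hb)
      rw [support_monomial, if_neg one_ne_zero, Finset.mem_singleton] at hc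
      subst hc
      obtain ⟨a, ha, rfl⟩ := (rename_support_val p).mp hd
      refine (dominates_localizedSupport_iff.mp (mem_borelIdeal.mp hp a ha)).trans
        (dominates_of_subset ?_)
      rw [← support_mapDomain_val]
      refine Finset.union_subset ?_ ?_
      · exact Finsupp.support_mono le_add_self
      · have := Finsupp.support_mono (le_self_add (a := squarefreeVector A)
          (b := a.mapDomain Subtype.val))
        rwa [support_squarefreeVector] at this

end Localize

/-! ### Powers -/

section Power

variable {n : ℕ}

/-- The numerical form of `x^a ∈ I^k` for the ideal `I` with Borel generator supported on `T`: every
initial segment of `a`, cut off at `k`, sums to at least `k` times the size of that of `T`. -/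
def DominatesPow (T : Finset (Fin n)) (k : ℕ) (a : Fin n →₀ ℕ) : Prop :=
  ∀ j ≤ n, k * headCount T j ≤ headSum (fun i => min (a i) k) j

theorem headSum_le_mul {c : Fin n → ℕ} {k : ℕ} (hc : ∀ i, c i ≤ k) :
    ∀ j ≤ n, headSum c j ≤ k * j := by
  refine head_induction (by simp [headSum_zero]) fun i ih => ?_
  have := hc i
  rw [headSum_succ]
  linarith

theorem headSum_ite_eq (i : Fin n) (v j : ℕ) :
    headSum (fun x => if x = i then v else 0) j = if (i : ℕ) < j then v else 0 := by
  rw [headSum, Finset.sum_ite_eq']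
  simp

theorem sum_range_add_div {k : ℕ} (hk : 0 < k) (s : ℕ) :
    ∑ l ∈ Finset.range k, (s + l) / k = s := by
  induction s with
  | zero =>
    refine Finset.sum_eq_zero fun l hl => ?_
    rw [zero_add]
    exact Nat.div_eq_of_lt (Finset.mem_range.mp hl)
  | succ s ih =>
    have h1 := Finset.sum_range_succ (fun l => (s + l) / k) k
    have h2 := Finset.sum_range_succ' (fun l => (s + l) / k) k
    have h3 : (s + k) / k = s / k + 1 := Nat.add_div_right s hk
    have h4 : ∀ l, (s + 1 + l) / k = (s + (l + 1)) / k := fun l => by congr 1; ring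
    simp only [h4, add_zero] at h2 ⊢
    omega

theorem dominatesPow_zero (T : Finset (Fin n)) (a : Fin n →₀ ℕ) : DominatesPow T 0 a :=
  fun j _ => by rw [zero_mul]; exact Nat.zero_le _

theorem DominatesPow.add {T : Finset (Fin n)} {k : ℕ} {a b : Fin n →₀ ℕ}
    (ha : DominatesPow T k a) (hb : Dominates T b.support) : DominatesPow T (k + 1) (a + b) := by
  intro j hj
  have h1 := ha j hj
  have h2 := dominates_iff_headCount.mp hb j hj
  rw [headCount_eq_headSum b.support] at h2
  calc (k + 1) * headCount T j
      ≤ headSum (fun i => min (a i) k) j + headSum (fun i => if i ∈ b.support then 1 else 0) j := by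
        linarith
    _ = headSum (fun i => min (a i) k + if i ∈ b.support then 1 else 0) j :=
        (headSum_add _ _ j).symm
    _ ≤ _ := headSum_le_headSum (fun i => by
        rw [Finsupp.add_apply]
        split_ifs with hi
        · rw [Finsupp.mem_support_iff] at hi
          omega
        · omega) j

/-- Cut the exponents of `x^a` off at `k`, and let `S j` be the partial sums. The `l`-th of the `k`
factors consists of the variables at which `(S j + l) / k` increases, necessarily by one as the cut
exponents are at most `k`. By Hermite's identity every index occurs in as many factors as its cut
exponent says. -/
theorem DominatesPow.exists_factors {T : Finset (Fin n)} {k : ℕ} {a : Fin n →₀ ℕ} (hk : 0 < k)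
    (h : DominatesPow T k a) : ∃ B : ℕ → Finset (Fin n), (∀ l ∈ Finset.range k, Dominates T (B l)) ∧
      ∑ l ∈ Finset.range k, squarefreeVector (B l) ≤ a := by
  set S := headSum (fun i => min (a i) k) with hS
  have hmono : ∀ l, Monotone fun j => (S j + l) / k := fun l i j hij =>
    Nat.div_le_div_right (Nat.add_le_add_right (headSum_mono _ hij) l)
  have hstep : ∀ l, ∀ i : Fin n, (S (i + 1) + l) / k ≤ (S i + l) / k + 1 := by
    intro l i
    rw [← Nat.add_div_right _ hk]
    refine Nat.div_le_div_right ?_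
    rw [hS, headSum_succ]
    have := min_le_right (a i) k
    omega
  refine ⟨fun l => jumps n fun j => (S j + l) / k, fun l hl => ?_, fun i => ?_⟩
  · rw [dominates_iff_headCount]
    intro j hj
    have h1 := headCount_jumps (hmono l) (hstep l) j hj
    have h2 : (S 0 + l) / k = 0 := by
      rw [hS, headSum_zero, zero_add]
      exact Nat.div_eq_of_lt (Finset.mem_range.mp hl)
    rw [h2, add_zero] at h1
    rw [h1, Nat.le_div_iff_mul_le hk, mul_comm]
    exact (h j hj).trans (Nat.le_add_right _ _)
  · have hsum : ∑ l ∈ Finset.range k, squarefreeVector (jumps n fun j => (S j + l) / k) i +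
        ∑ l ∈ Finset.range k, (S i + l) / k = ∑ l ∈ Finset.range k, (S (i + 1) + l) / k := by
      rw [← Finset.sum_add_distrib]
      refine Finset.sum_congr rfl fun l _ => ?_
      have h1 := hmono l (Nat.le_succ (i : ℕ))
      have h2 := hstep l i
      rw [squarefreeVector_apply]
      simp only [mem_jumps]
      simp only [Nat.succ_eq_add_one] at h1
      split_ifs <;> omega
    rw [sum_range_add_div hk, sum_range_add_div hk] at hsum
    have hSi : S (i + 1) = S i + min (a i) k := headSum_succ _ i
    rw [Finsupp.finsetSum_apply]
    change ∑ l ∈ Finset.range k, squarefreeVector (jumps n fun j => (S j + l) / k) i ≤ a i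
    omega

variable {K : Type*} [Field K]

theorem mem_borelIdeal_pow {T : Finset (Fin n)} {k : ℕ} {p : MvPolynomial (Fin n) K} :
    p ∈ borelIdeal K T ^ k ↔ ∀ a ∈ p.support, DominatesPow T k a := by
  classical
  constructor
  · induction k generalizing p with
    | zero => exact fun _ a _ => dominatesPow_zero T a
    | succ k ih =>
      intro hp
      rw [pow_succ] at hp
      induction hp using Submodule.mul_induction_on' with
      | mem_mul_mem r hr s hs =>
        intro a ha
        obtain ⟨b, hb, c, hc, rfl⟩ := Finset.mem_add.mp (support_mul _ _ ha)
        exact (ih hr b hb).add (mem_borelIdeal.mp hs c hc)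
      | add x _ y _ hx hy =>
        intro a ha
        rcases Finset.mem_union.mp (support_add ha) with h | h
        · exact hx a h
        · exact hy a h
  · intro h
    rw [p.as_sum]
    refine Ideal.sum_mem _ fun a ha => ?_
    rcases k.eq_zero_or_pos with rfl | hk
    · simp
    obtain ⟨B, hB, hle⟩ := (h a ha).exists_factors hk
    have hprod : monomial (∑ l ∈ Finset.range k, squarefreeVector (B l)) (1 : K) ∈
        borelIdeal K T ^ k := by
      rw [monomial_sum_one]
      have := Ideal.prod_mem_prod (s := Finset.range k) (I := fun _ => borelIdeal K T)
        (x := fun l => monomial (squarefreeVector (B l)) (1 : K)) fun l hl => by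
          rw [monomial_mem_borelIdeal, support_squarefreeVector]
          exact hB l hl
      rwa [Finset.prod_const, Finset.card_range] at this
    have hmul : monomial a (coeff a p) =
        monomial (a - ∑ l ∈ Finset.range k, squarefreeVector (B l)) (coeff a p) *
          monomial (∑ l ∈ Finset.range k, squarefreeVector (B l)) 1 := by
      rw [monomial_mul, mul_one, tsub_add_cancel_of_le hle]
    rw [hmul]
    exact Ideal.mul_mem_left _ _ hprod

/-! ### Associated primes of powers -/

theorem DominatesPow.of_min_le {T : Finset (Fin n)} {k : ℕ} {a b : Fin n →₀ ℕ}
    (ha : DominatesPow T k a) (h : ∀ i, min (a i) k ≤ b i) : DominatesPow T k b := fun j hj =>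
  (ha j hj).trans (headSum_le_headSum (fun i => le_min (h i) (min_le_right _ _)) j)

/-- `P_A` is associated to `S / I^k` precisely if it is the annihilator of a monomial `x^a` which is
divisible by `x_i^k` for all `i ∈ A`; the last condition reflects that exponents above `k` do not
matter for membership in `I^k`. -/
theorem monomialPrime_mem_associatedPrimes_iff {T A : Finset (Fin n)} {k : ℕ} :
    monomialPrime K A ∈ associatedPrimes (MvPolynomial (Fin n) K)
        (MvPolynomial (Fin n) K ⧸ borelIdeal K T ^ k) ↔
      ∃ a : Fin n →₀ ℕ, (∀ i ∈ A, k ≤ a i) ∧ ¬ DominatesPow T k a ∧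
        ∀ i ∉ A, DominatesPow T k (a + Finsupp.single i 1) := by
  classical
  rw [AssociatedPrimes.mem_iff, isAssociatedPrime_iff]
  constructor
  · rintro ⟨-, x, hx⟩
    obtain ⟨p, rfl⟩ := Ideal.Quotient.mk_surjective x
    have hmem : ∀ f, f ∈ monomialPrime K A ↔ f * p ∈ borelIdeal K T ^ k := by
      intro f
      rw [hx, Submodule.mem_colon_singleton, Submodule.mem_bot, ← Ideal.Quotient.eq_zero_iff_mem,
        map_mul]
      rfl
    have hnot : monomial (k • squarefreeVector A) (1 : K) ∉ monomialPrime K A := by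
      refine notMem_monomialPrime_iff.mpr ⟨k • squarefreeVector A, ?_, ?_⟩
      · rw [support_monomial, if_neg one_ne_zero, Finset.mem_singleton]
      · refine Finsupp.support_smul.trans ?_
        rw [support_squarefreeVector]
    rw [hmem, mem_borelIdeal_pow] at hnot
    push Not at hnot
    obtain ⟨a, ha, hd⟩ := hnot
    obtain ⟨c, hc, b, hb, rfl⟩ := Finset.mem_add.mp (support_mul _ _ ha)
    rw [support_monomial, if_neg one_ne_zero, Finset.mem_singleton] at hc
    subst hc
    refine ⟨_, fun i hi => ?_, hd, fun i hi => ?_⟩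
    · rw [Finsupp.add_apply, Finsupp.smul_apply, squarefreeVector_apply, if_pos hi]
      simp
    · have hXi : (X i : MvPolynomial (Fin n) K) ∈ monomialPrime K A :=
        Ideal.subset_span ⟨i, hi, rfl⟩
      rw [hmem, mem_borelIdeal_pow] at hXi
      refine (hXi (Finsupp.single i 1 + b) ?_).of_min_le fun x => ?_
      · rw [mem_support_iff, coeff_X_mul]
        exact mem_support_iff.mp hb
      · simp only [Finsupp.add_apply]
        omega
  · rintro ⟨a, hA, hd, hi⟩
    refine ⟨inferInstance, Ideal.Quotient.mk _ (monomial a 1), ?_⟩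
    ext f
    rw [Submodule.mem_colon_singleton, Submodule.mem_bot]
    have hsmul : f • Ideal.Quotient.mk (borelIdeal K T ^ k) (monomial a (1 : K)) =
        Ideal.Quotient.mk _ (f * monomial a 1) := rfl
    rw [hsmul, Ideal.Quotient.eq_zero_iff_mem]
    constructor
    · intro hf
      rw [mem_borelIdeal_pow]
      intro b hb
      obtain ⟨c, hc, d, hd', rfl⟩ := Finset.mem_add.mp (support_mul _ _ hb)
      rw [support_monomial, if_neg one_ne_zero, Finset.mem_singleton] at hd'
      subst hd'
      rw [monomialPrime, mem_ideal_span_X_image] at hf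
      obtain ⟨i, hiA, hci⟩ := hf c hc
      refine (hi i hiA).of_min_le fun x => (min_le_left _ _).trans ?_
      rw [Finsupp.add_apply, Finsupp.add_apply, Finsupp.single_apply]
      split_ifs with h
      · subst h
        omega
      · omega
    · intro hf
      by_contra hnot
      obtain ⟨c, hc, hcA⟩ := notMem_monomialPrime_iff.mp hnot
      refine hd ((mem_borelIdeal_pow.mp hf (c + a) ?_).of_min_le fun i => ?_)
      · rw [mem_support_iff, coeff_mul_monomial, mul_one]
        exact mem_support_iff.mp hc
      · rw [Finsupp.add_apply]
        by_cases h : i ∈ A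
        · exact (min_le_right _ _).trans (hA i h)
        · have : c i = 0 := by
            by_contra hci
            exact h (hcA (Finsupp.mem_support_iff.mpr hci))
          omega

theorem headSum_min_add_single (a : Fin n →₀ ℕ) (i : Fin n) (k j : ℕ) :
    headSum (fun x => min ((a + Finsupp.single i 1 : Fin n →₀ ℕ) x) k) j =
      headSum (fun x => min (a x) k) j + if (i : ℕ) < j then (if a i < k then 1 else 0) else 0 := by
  rw [← headSum_ite_eq, ← headSum_add]
  congr 1
  funext x
  rw [Finsupp.add_apply, Finsupp.single_apply]
  by_cases h : i = x
  · subst h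
    simp only [if_true]
    split_ifs <;> omega
  · rw [if_neg h, if_neg (Ne.symm h), add_zero, add_zero]

theorem headSum_add_mul_le {A : Finset (Fin n)} {c : Fin n → ℕ} {k : ℕ} (hc : ∀ i ∈ A, k ≤ c i)
    (j : ℕ) : ∀ m ≤ n, j ≤ m →
      headSum c j + k * headCount A m ≤ headSum c m + k * headCount A j := by
  refine head_induction (fun h => ?_) fun i ih hj => ?_
  · rw [Nat.le_zero.mp h]
  · rcases hj.eq_or_lt with rfl | hlt
    · exact le_rfl
    · have h1 := ih (by omega)
      rw [headSum_succ, headCount_succ]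
      split_ifs with hi
      · have := hc i hi
        rw [mul_add]
        omega
      · rw [add_zero]
        omega

theorem headCount_eq_of_last {A : Finset (Fin n)} {q : Fin n} (hq : ∀ i, q < i → i ∈ A) :
    ∀ j ≤ n, (q : ℕ) + 1 ≤ j → headCount A j = headCount A (q + 1) + (j - (q + 1)) := by
  refine head_induction (by omega) fun i ih hj => ?_
  rcases hj.eq_or_lt with h | hlt
  · rw [← h]
    omega
  · rw [headCount_succ, ih (by omega), if_pos (hq i (by rw [Fin.lt_def]; omega))]
    omega

/-- The two conditions say that the last index `q` outside `A` belongs to the support of the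
localized Borel generator, and that the first such index does not unless it is `q`. -/
theorem conditions_of_associated {T A : Finset (Fin n)} {q : Fin n} (hqA : q ∉ A)
    (hq : ∀ i, q < i → i ∈ A) {k : ℕ}
    (h : ∃ a : Fin n →₀ ℕ, (∀ i ∈ A, k ≤ a i) ∧ ¬ DominatesPow T k a ∧
        ∀ i ∉ A, DominatesPow T k (a + Finsupp.single i 1)) :
    (∀ j ≤ (q : ℕ), headCount T j + headCount A (q + 1) < headCount T (q + 1) + headCount A j) ∧
      ∀ p ∉ A, p < q → ∃ i ≤ p, i ∉ T := by
  obtain ⟨a, haA, hd, hai⟩ := h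
  unfold DominatesPow at hd
  push Not at hd
  obtain ⟨m, hmn, hm⟩ := hd
  set S := headSum fun i => min (a i) k with hS
  have hdom : ∀ i ∉ A, ∀ j ≤ n,
      k * headCount T j ≤ S j + if (i : ℕ) < j then (if a i < k then 1 else 0) else 0 := by
    intro i hi j hj
    have := hai i hi j hj
    rwa [headSum_min_add_single] at this
  have hsmall : ∀ i ∉ A, (i : ℕ) < m ∧ a i < k := by
    intro i hi
    have := hdom i hi m hmn
    split_ifs at this with h1 h2
    · exact ⟨h1, h2⟩
    · omega
    · omega
  have hc : ∀ i ∈ A, k ≤ min (a i) k := fun i hi => le_min (haA i hi) le_rfl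
  have hqm : (q : ℕ) + 1 ≤ m := (hsmall q hqA).1
  have hSq : S (q + 1) < k * headCount T (q + 1) := by
    have h1 := headSum_add_mul_le hc (q + 1) m hmn hqm
    have h2 := headCount_le_add_sub T (q + 1) m hmn hqm
    rw [headCount_eq_of_last hq m hmn hqm, ← hS] at h1
    have h3 := Nat.mul_le_mul_left k h2
    rw [mul_add] at h1 h3
    omega
  have hlow : ∀ j ≤ (q : ℕ), k * headCount T j ≤ S j := by
    intro j hj
    have := hdom q hqA j (by omega)
    rwa [if_neg (by omega), add_zero] at this
  refine ⟨fun j hj => ?_, fun p hp hpq => ?_⟩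
  · have h1 := headSum_add_mul_le hc j (q + 1) q.2 (by omega)
    have h2 := hlow j hj
    rw [← hS] at h1
    refine Nat.lt_of_mul_lt_mul_left (a := k) ?_
    rw [mul_add, mul_add]
    change _ + k * headCount A (q + 1) ≤ _ at h1
    omega
  · by_contra! hT
    have h1 := hlow (p + 1) (by rw [Fin.lt_def] at hpq; omega)
    rw [(headCount_eq_iff T (p + 1) p.2).mpr fun i hi => hT i (by rw [Fin.le_def]; omega), hS,
      headSum_succ, mul_add] at h1
    have h2 := headSum_le_mul (fun i => min_le_right (a i) k) p p.2.le
    have h3 := (hsmall p hp).2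
    omega

theorem headCount_compl_add (A : Finset (Fin n)) :
    ∀ j ≤ n, headCount Aᶜ j + headCount A j = j := by
  refine head_induction (by simp [headCount_zero]) fun i ih => ?_
  rw [headCount_succ, headCount_succ]
  simp only [Finset.mem_compl]
  split_ifs <;> omega

/-- The witness has exponent `k` at the indices in `A`. Off `A` it starts with exponents `k - 1`,
until the sum `k * d - 1` is reached, where `d` is the degree of the localized generator: one less
than membership in the `k`-th power requires, and as far to the front as is possible with exponents
below `k`. -/
theorem associated_of_conditions {T A : Finset (Fin n)} {q : Fin n} (hqA : q ∉ A)
    (hq : ∀ i, q < i → i ∈ A) {k : ℕ} (hk : n ≤ k)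
    (h2 : ∀ j ≤ (q : ℕ),
      headCount T j + headCount A (q + 1) < headCount T (q + 1) + headCount A j)
    (h1 : ∀ p ∉ A, p < q → ∃ i ≤ p, i ∉ T) :
    ∃ a : Fin n →₀ ℕ, (∀ i ∈ A, k ≤ a i) ∧ ¬ DominatesPow T k a ∧
        ∀ i ∉ A, DominatesPow T k (a + Finsupp.single i 1) := by
  have hk0 : 0 < k := (Nat.zero_le _).trans_lt (q.2.trans_le hk)
  obtain ⟨d, hd⟩ : ∃ d, headCount T (q + 1) = headCount A (q + 1) + d + 1 := by
    have := h2 0 (Nat.zero_le _)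
    rw [headCount_zero, headCount_zero] at this
    exact ⟨headCount T (q + 1) - headCount A (q + 1) - 1, by omega⟩
  obtain ⟨l, rfl⟩ : ∃ l, k = l + 1 := ⟨k - 1, by omega⟩
  set G : ℕ → ℕ := fun r => min (r * l) ((l + 1) * d + l) with hG
  have hGstep : ∀ r, G r ≤ G (r + 1) ∧ G (r + 1) ≤ G r + l := by
    intro r
    simp only [hG, add_mul, one_mul]
    omega
  set a : Fin n →₀ ℕ := Finsupp.equivFunOnFinite.symm fun i =>
    if i ∈ A then l + 1 else G (headCount Aᶜ i + 1) - G (headCount Aᶜ i) with ha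
  have hapos : ∀ i ∈ A, a i = l + 1 := fun i hi => if_pos hi
  have haneg : ∀ i ∉ A, a i = G (headCount Aᶜ i + 1) - G (headCount Aᶜ i) := fun i hi => if_neg hi
  have halt : ∀ i ∉ A, a i < l + 1 := by
    intro i hi
    rw [haneg i hi]
    have := hGstep (headCount Aᶜ i)
    omega
  have hsum : ∀ j ≤ n, headSum (fun i => min (a i) (l + 1)) j =
      (l + 1) * headCount A j + G (headCount Aᶜ j) := by
    refine head_induction (by simp [headSum_zero, headCount_zero, hG]) fun i ih => ?_
    rw [headSum_succ, ih, headCount_succ, headCount_succ]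
    by_cases hi : i ∈ A
    · rw [hapos i hi, if_pos hi, if_neg (by simpa using hi), min_self, mul_add,
        add_zero, mul_one]
      omega
    · have := hGstep (headCount Aᶜ i)
      rw [min_eq_left (halt i hi).le, haneg i hi, if_neg hi, if_pos (by simpa using hi), add_zero]
      omega
  have hN := headCount_compl_add A
  -- an initial segment contained in `T` and not containing `q` is contained in `A`
  have hfull : ∀ j ≤ (q : ℕ), headCount T j = j → headCount A j = j := by
    intro j hj hTj
    rw [headCount_eq_iff _ _ (by omega)] at hTj ⊢
    intro p hp
    by_contra hpA
    obtain ⟨i, hip, hiT⟩ := h1 p hpA (by rw [Fin.lt_def]; omega)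
    exact hiT (hTj i (by rw [Fin.le_def] at hip; omega))
  refine ⟨a, fun i hi => (hapos i hi).ge, fun hdom => ?_, fun i hi j hj => ?_⟩
  · have h3 : (l + 1) * headCount T (q + 1) ≤ headSum (fun i => min (a i) (l + 1)) (q + 1) :=
      hdom (q + 1) q.2
    rw [hsum (q + 1) q.2, hd] at h3
    have h4 : G (headCount Aᶜ (q + 1)) ≤ (l + 1) * d + l := min_le_right _ _
    have h5 : (l + 1) * (headCount A (q + 1) + d + 1) =
      (l + 1) * headCount A (q + 1) + (l + 1) * d + (l + 1) := by ring
    omega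
  · rw [headSum_min_add_single, hsum j hj, if_pos (halt i hi)]
    have hiq : i ≤ q := by
      by_contra hlt
      exact hi (hq i (not_le.mp hlt))
    rw [Fin.le_def] at hiq
    by_cases hjq : j ≤ q
    · -- the segments before `q` satisfy the requirement already without the extra variable
      suffices h : (l + 1) * headCount T j ≤ (l + 1) * headCount A j + G (headCount Aᶜ j) from
        h.trans (Nat.le_add_right _ _)
      by_cases hTA : headCount T j ≤ headCount A j
      · exact (Nat.mul_le_mul_left _ hTA).trans (Nat.le_add_right _ _)
      obtain ⟨e, he⟩ : ∃ e, headCount T j = headCount A j + e := ⟨_, (by omega : _ =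
        headCount A j + (headCount T j - headCount A j))⟩
      have h3 := h2 j hjq
      have h4 := hN j hj
      have h5 := headCount_le T j hj
      have h6 : headCount T j ≠ j := fun h => hTA (by rw [hfull j hjq h]; omega)
      rw [he, mul_add]
      refine Nat.add_le_add_left (le_min ?_ ?_) _
      · obtain ⟨r, hr⟩ : ∃ r, headCount Aᶜ j = e + 1 + r := ⟨headCount Aᶜ j - (e + 1), by omega⟩
        have : e ≤ l := by omega
        rw [hr]
        nlinarith
      · have h7 := Nat.mul_le_mul_left (l + 1) (show e ≤ d by omega)
        omega
    · rw [if_pos (by omega)]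
      have h3 := headCount_eq_of_last hq j hj (by omega)
      have h4 := headCount_le_add_sub T (q + 1) j hj (by omega)
      have h5 := hN j hj
      have h6 := hN (q + 1) q.2
      have h7 := headCount_le T (q + 1) q.2
      -- the capacity off `A` suffices for the sum `k * d - 1`
      have hcap : (l + 1) * d + l ≤ headCount Aᶜ j * l := by
        by_cases hT : headCount T (q + 1) = q + 1
        · have h8 := hfull q le_rfl ((headCount_eq_iff T q q.2.le).mpr fun i hi =>
            (headCount_eq_iff T (q + 1) q.2).mp hT i (by omega))
          have h9 := headCount_succ A q
          rw [if_neg hqA] at h9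
          have h10 : d = 0 := by omega
          have h11 : headCount Aᶜ j = 1 := by omega
          rw [h10, h11]
          omega
        · obtain ⟨r, hr⟩ : ∃ r, headCount Aᶜ j = d + 2 + r := ⟨headCount Aᶜ j - (d + 2), by omega⟩
          have : d ≤ l := by omega
          rw [hr]
          nlinarith
      have h12 : G (headCount Aᶜ j) = (l + 1) * d + l := min_eq_right hcap
      rw [h12]
      have h13 := Nat.mul_le_mul_left (l + 1) (show headCount T j ≤ headCount A j + d + 1 by omega)
      have h14 : (l + 1) * (headCount A j + d + 1) =
        (l + 1) * headCount A j + (l + 1) * d + (l + 1) := by ring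
      omega

theorem monomialPrime_mem_stableAss_iff {T A : Finset (Fin n)} {q : Fin n} (hqA : q ∉ A)
    (hq : ∀ i, q < i → i ∈ A) :
    monomialPrime K A ∈ stableAss (borelIdeal K T) ↔
      (∀ j ≤ (q : ℕ), headCount T j + headCount A (q + 1) < headCount T (q + 1) + headCount A j) ∧
        ∀ p ∉ A, p < q → ∃ i ≤ p, i ∉ T := by
  rw [stableAss, Set.mem_ofPred_eq]
  simp only [monomialPrime_mem_associatedPrimes_iff]
  constructor
  · intro h
    obtain ⟨k, hk⟩ := h.exists
    exact conditions_of_associated hqA hq hk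
  · rintro ⟨h2, h1⟩
    filter_upwards [Filter.eventually_ge_atTop n] with k hk
    exact associated_of_conditions hqA hq hk h2 h1

end Power

/-! ### The conditions on the generator in terms of indices -/

section Entries

variable {n : ℕ}

theorem headCount_orderEmbOfFin (T : Finset (Fin n)) (r : Fin T.card) :
    headCount T (T.orderEmbOfFin rfl r : Fin n) = r := by
  have h : (T.filter fun i : Fin n => (i : ℕ) < (T.orderEmbOfFin rfl r : Fin n)) =
      (Finset.Iio r).map (T.orderEmbOfFin rfl).toEmbedding := by
    ext i
    simp only [Finset.mem_filter, Finset.mem_map, Finset.mem_Iio,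
      RelEmbedding.coe_toEmbedding, ← Fin.lt_def]
    constructor
    · rintro ⟨hi, hlt⟩
      have : i ∈ Set.range (T.orderEmbOfFin rfl) := by
        rw [Finset.range_orderEmbOfFin]
        exact hi
      obtain ⟨s, rfl⟩ := this
      exact ⟨s, (T.orderEmbOfFin rfl).lt_iff_lt.mp hlt, rfl⟩
    · rintro ⟨s, hs, rfl⟩
      exact ⟨T.orderEmbOfFin_mem rfl s, (T.orderEmbOfFin rfl).lt_iff_lt.mpr hs⟩
  rw [headCount, h, Finset.card_map, Fin.card_Iio]

theorem entry_zero (T : Finset (Fin n)) : entry T 0 = 0 := rfl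

/-- The `r`-th index of `T` and the number of elements in an initial segment are adjoint. -/
theorem entry_le_iff (T : Finset (Fin n)) {r j : ℕ} (hj : j ≤ n) :
    entry T r ≤ j ↔ r ≤ headCount T j := by
  rcases r with _ | r
  · simp [entry_zero]
  · by_cases hr : r < T.card
    · have h1 := headCount_orderEmbOfFin T ⟨r, hr⟩
      have h2 := headCount_succ T (T.orderEmbOfFin rfl ⟨r, hr⟩)
      rw [if_pos (T.orderEmbOfFin_mem rfl _), h1] at h2
      simp only [entry, dif_pos hr]
      constructor
      · intro h
        exact h2.ge.trans (headCount_mono T h)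
      · intro h
        by_contra hlt
        have := headCount_mono T (show j ≤ (T.orderEmbOfFin rfl ⟨r, hr⟩ : Fin n) by omega)
        rw [h1] at this
        simp only at this
        omega
    · simp only [entry, dif_neg hr]
      have := headCount_le_card T j
      omega

theorem lt_entry_iff (T : Finset (Fin n)) {r j : ℕ} (hj : j ≤ n) :
    j < entry T r ↔ headCount T j < r := by
  rw [← not_le, entry_le_iff T hj, not_le]

theorem entry_le_succ (T : Finset (Fin n)) (r : ℕ) : entry T r ≤ n + 1 := by
  rcases r with _ | r
  · simp [entry_zero]
  · rw [entry]
    split_ifs <;> omega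

theorem entry_eq_self_iff (T : Finset (Fin n)) {t : ℕ} (ht : t ≤ n) :
    entry T t = t ↔ headCount T t = t := by
  have h1 := entry_le_iff T (r := t) ht
  have h2 := headCount_le T t ht
  have h3 : t ≤ entry T t := by
    by_contra h
    have h4 := (entry_le_iff T (r := t) (j := entry T t) (by omega)).mp le_rfl
    have h5 := headCount_le T (entry T t) (by omega)
    omega
  omega

/-- `numH T` is the length of the longest initial segment contained in `T`. -/
theorem numH_spec (T : Finset (Fin n)) :
    numH T ≤ n ∧ headCount T (numH T) = numH T ∧
      ∀ t : Fin n, (∀ i ≤ t, i ∈ T) → (t : ℕ) < numH T := by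
  have hcn : T.card ≤ n := by simpa using T.card_le_univ
  have hne : {j | j = T.card ∨ (j < T.card ∧ entry T j + 1 < entry T (j + 1))}.Nonempty :=
    ⟨T.card, Or.inl rfl⟩
  have hmem : numH T = T.card ∨
      (numH T < T.card ∧ entry T (numH T) + 1 < entry T (numH T + 1)) := Nat.sInf_mem hne
  have hleast : ∀ j < numH T, entry T (j + 1) ≤ entry T j + 1 := by
    intro j hj
    have h1 : ¬ (j = T.card ∨ (j < T.card ∧ entry T j + 1 < entry T (j + 1))) :=
      Nat.notMem_of_lt_sInf hj
    push Not at h1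
    exact h1.2 (by omega)
  have hHn : numH T ≤ n := by omega
  have heq : ∀ t ≤ numH T, entry T t = t := by
    intro t
    induction t with
    | zero => exact fun _ => entry_zero T
    | succ t ih =>
      intro ht
      have h1 := hleast t (by omega)
      rw [ih (by omega), entry_le_iff T (by omega)] at h1
      rw [entry_eq_self_iff T (by omega)]
      exact le_antisymm (headCount_le T _ (by omega)) h1
  refine ⟨hHn, (entry_eq_self_iff T hHn).mp (heq _ le_rfl), fun t ht => ?_⟩
  by_contra hlt
  have hfull : headCount T (numH T + 1) = numH T + 1 :=
    (headCount_eq_iff T _ (by omega)).mpr fun i hi => ht i (by rw [Fin.le_def]; omega)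
  rcases hmem with h | ⟨-, h⟩
  · have := headCount_le_card T (numH T + 1)
    omega
  · rw [heq _ le_rfl, (entry_eq_self_iff T (by omega)).mpr hfull] at h
    exact lt_irrefl _ h

theorem forall_entry_eq_iff (T A : Finset (Fin n)) :
    (∀ t ≤ numH T, entry A t = t) ↔ ∀ t : Fin n, (∀ i ≤ t, i ∈ T) → t ∈ A := by
  obtain ⟨hn, hT, hmax⟩ := numH_spec T
  constructor
  · intro h t ht
    have h1 := (entry_eq_self_iff A hn).mp (h _ le_rfl)
    exact (headCount_eq_iff A _ hn).mp h1 t (hmax t ht)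
  · intro h t ht
    rw [entry_eq_self_iff A (ht.trans hn), headCount_eq_iff A t (ht.trans hn)]
    intro i hi
    refine h i fun x hx => (headCount_eq_iff T _ hn).mp hT x ?_
    rw [Fin.le_def] at hx
    omega

section Last

variable {A : Finset (Fin n)} {q : Fin n}

theorem entry_headCount_last (hqA : q ∉ A) (hq : ∀ i, q < i → i ∈ A) :
    entry A (headCount A q + 1) = q + 2 := by
  have h1 := headCount_succ A q
  rw [if_neg hqA, add_zero] at h1
  have h2 : (q : ℕ) + 1 < entry A (headCount A q + 1) := by
    rw [lt_entry_iff A q.2]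
    change headCount A (q + 1) < _
    omega
  have h3 := entry_le_succ A (headCount A q + 1)
  by_cases hn : (q : ℕ) + 1 < n
  · have h4 := headCount_eq_of_last hq (q + 2) hn (by omega)
    have h5 := (entry_le_iff A (r := headCount A q + 1) (j := q + 2) hn).mpr (by omega)
    omega
  · omega

theorem numF_eq (hqA : q ∉ A) (hq : ∀ i, q < i → i ∈ A) : numF A = headCount A q := by
  have h1 := headCount_succ A q
  rw [if_neg hqA, add_zero] at h1
  refine le_antisymm (Finset.sup_le fun r hr => ?_)
    (Finset.le_sup (f := id) (b := headCount A q) ?_)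
  · rw [Finset.mem_filter, Finset.mem_range] at hr
    obtain ⟨hrc, hlt⟩ := hr
    by_contra hlt'
    rw [id, not_le] at hlt'
    -- past `q`, consecutive entries of `A` differ by one
    have h2 : (q : ℕ) + 1 < entry A r := by
      rw [lt_entry_iff A q.2]
      change headCount A (q + 1) < _
      omega
    have h3 : entry A r ≤ n := by
      rw [entry_le_iff A le_rfl, headCount_of_le A le_rfl]
      omega
    have h4 := entry_le_succ A (r + 1)
    have h5 := (entry_le_iff A (r := r) h3).mp le_rfl
    have h6 := headCount_eq_of_last hq (entry A r) h3 (by omega)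
    have h7 := headCount_eq_of_last hq (entry A r + 1) (by omega) (by omega)
    have h8 := (entry_le_iff A (r := r + 1) (j := entry A r + 1) (by omega)).mpr (by omega)
    omega
  · have h2 := entry_headCount_last hqA hq
    have h3 := (entry_le_iff A (r := headCount A q) (j := q) q.2.le).mpr le_rfl
    have h4 := headCount_le_card A q
    rw [Finset.mem_filter, Finset.mem_range]
    omega

theorem numG_eq (T : Finset (Fin n)) (hqA : q ∉ A) (hq : ∀ i, q < i → i ∈ A) :
    numG T A = headCount T (q + 1) := by
  have he : entry A (numF A + 1) - 1 = q + 1 := by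
    rw [numF_eq hqA hq, entry_headCount_last hqA hq]
    rfl
  refine le_antisymm (Finset.sup_le fun t ht => ?_)
    (Finset.le_sup (f := id) (b := headCount T (q + 1)) ?_)
  · rw [Finset.mem_filter, he, entry_le_iff T q.2] at ht
    exact ht.2
  · have := headCount_le_card T (q + 1)
    rw [Finset.mem_filter, he, entry_le_iff T q.2, Finset.mem_range]
    exact ⟨by omega, le_rfl⟩

theorem numL_eq (T : Finset (Fin n)) {κ t : ℕ} (hκ : κ < n) (ht : entry A t = κ + 1) :
    numL T A t = headCount T κ + 1 := by
  have : {r | entry A t ≤ entry T r} = Set.Ici (headCount T κ + 1) := by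
    ext r
    change entry A t ≤ entry T r ↔ headCount T κ + 1 ≤ r
    rw [ht, Nat.succ_le_iff, lt_entry_iff T hκ.le, Nat.succ_le_iff]
  rw [numL, this, csInf_Ici]

theorem entry_headCount_of_mem {κ : Fin n} (h : κ ∈ A) : entry A (headCount A κ + 1) = κ + 1 := by
  have h1 := headCount_succ A κ
  rw [if_pos h] at h1
  have h2 := (entry_le_iff A (r := headCount A κ + 1) (j := κ + 1) κ.2).mpr (by omega)
  have h3 := (lt_entry_iff A (r := headCount A κ + 1) (j := κ) κ.2.le).mpr (by omega)
  omega

theorem exists_entry_eq {t : ℕ} (ht : 1 ≤ t) (htc : t ≤ headCount A q) :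
    ∃ κ ∈ A, κ < q ∧ entry A t = κ + 1 ∧ headCount A κ + 1 = t := by
  have h1 := (entry_le_iff A (r := t) (j := q) q.2.le).mpr htc
  have h2 := (lt_entry_iff A (r := t) (j := 0) (Nat.zero_le n)).mpr (by
    rw [headCount_zero]
    omega)
  obtain ⟨κ, hκ⟩ : ∃ κ, entry A t = κ + 1 := ⟨entry A t - 1, by omega⟩
  have hκn : κ < n := by omega
  have h3 := (entry_le_iff A (r := t) (j := κ + 1) hκn).mp hκ.le
  have h4 := (lt_entry_iff A (r := t) (j := κ) hκn.le).mp (by omega)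
  have h5 := headCount_succ A ⟨κ, hκn⟩
  simp only at h5
  have hmem : (⟨κ, hκn⟩ : Fin n) ∈ A := by
    by_contra h
    rw [if_neg h] at h5
    omega
  rw [if_pos hmem] at h5
  refine ⟨⟨κ, hκn⟩, hmem, ?_, hκ, ?_⟩
  · rw [Fin.lt_def]
    change κ < q
    omega
  · change headCount A κ + 1 = t
    omega

/-- Between two elements of `A` the difference `#(T ∩ J) - #(A ∩ J)` does not decrease, so it
suffices to compare its value after `q` with the values just before the elements of `A` and just
before `q`; these are the conditions on `numL` and on
the entry number `numG T A`. -/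
theorem index_condition_iff (T : Finset (Fin n)) (hqA : q ∉ A) (hq : ∀ i, q < i → i ∈ A) :
    (entry T (numG T A) = entry A (numF A + 1) - 1 ∧
        ∀ j < numF A, numL T A (numF A - j) < numG T A - j) ↔
      ∀ j ≤ (q : ℕ),
        headCount T j + headCount A (q + 1) < headCount T (q + 1) + headCount A j := by
  have hα := headCount_succ A q
  rw [if_neg hqA, add_zero] at hα
  have hlast : entry T (headCount T (q + 1)) = q + 1 ↔ headCount T q < headCount T (q + 1) := by
    have h1 := (entry_le_iff T (r := headCount T (q + 1)) (j := q + 1) q.2).mpr le_rfl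
    have h2 := lt_entry_iff T (r := headCount T (q + 1)) (j := q) q.2.le
    omega
  rw [numG_eq T hqA hq, numF_eq hqA hq, entry_headCount_last hqA hq, hα]
  change (entry T (headCount T (q + 1)) = q + 1 ∧ _) ↔ _
  rw [hlast]
  constructor
  · rintro ⟨h1, h2⟩
    have key : ∀ d ≤ (q : ℕ), headCount T (q - d) + headCount A q <
        headCount T (q + 1) + headCount A (q - d) := by
      intro d
      induction d with
      | zero =>
        intro _
        rw [Nat.sub_zero]
        omega
      | succ d ih =>
        intro hd
        have h3 := ih (by omega)
        obtain ⟨κ, hκ⟩ : ∃ κ : Fin n, (κ : ℕ) = q - (d + 1) := ⟨⟨q - (d + 1), by omega⟩, rfl⟩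
        have hκ' : (q : ℕ) - d = κ + 1 := by omega
        rw [hκ'] at h3
        rw [← hκ]
        have h4 := headCount_succ A κ
        by_cases hκA : κ ∈ A
        · rw [if_pos hκA] at h4
          have h5 := headCount_mono A (show (κ : ℕ) + 1 ≤ q by omega)
          have h6 := h2 (headCount A q - (headCount A κ + 1)) (by omega)
          have h7 : headCount A q - (headCount A q - (headCount A κ + 1)) =
            headCount A κ + 1 := by omega
          rw [h7, numL_eq T κ.2 (entry_headCount_of_mem hκA)] at h6
          omega
        · rw [if_neg hκA] at h4
          have h5 := headCount_mono T (Nat.le_succ (κ : ℕ))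
          simp only [Nat.succ_eq_add_one] at h5
          omega
    intro j hj
    have := key (q - j) (by omega)
    rwa [show (q : ℕ) - (q - j) = j by omega] at this
  · intro h
    refine ⟨by have := h q le_rfl; omega, fun j hj => ?_⟩
    obtain ⟨κ, -, hκq, hκ, hc⟩ := exists_entry_eq (A := A) (q := q)
      (t := headCount A q - j) (by omega) (by omega)
    rw [numL_eq T κ.2 hκ]
    have := h κ (by rw [Fin.lt_def] at hκq; omega)
    omega

theorem max_localizedSupport_iff (T : Finset (Fin n)) (hqA : q ∉ A) (hq : ∀ i, q < i → i ∈ A) :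
    (localizedSupport T A).max = (Finset.univ : Finset {i : Fin n // i ∉ A}).max ↔
      ∀ j ≤ (q : ℕ),
        headCount T j + headCount A (q + 1) < headCount T (q + 1) + headCount A j := by
  have hle : ∀ i : {i : Fin n // i ∉ A}, i ≤ ⟨q, hqA⟩ := fun i =>
    not_lt.mp fun hlt => i.2 (hq i hlt)
  have huniv : (Finset.univ : Finset {i : Fin n // i ∉ A}).max = ((⟨q, hqA⟩ : {i // i ∉ A}) :
      WithBot {i : Fin n // i ∉ A}) :=
    le_antisymm (Finset.max_le fun i _ => WithBot.coe_le_coe.mpr (hle i))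
      (Finset.le_max (Finset.mem_univ _))
  rw [huniv, ← excess_lt_excess_succ_iff]
  change _ ↔ _ < excess T A (((⟨q, hqA⟩ : {i : Fin n // i ∉ A}) : Fin n) + 1)
  rw [← mem_localizedSupport (i := ⟨q, hqA⟩)]
  exact ⟨Finset.mem_of_max, fun h => le_antisymm
    (Finset.max_le fun i _ => WithBot.coe_le_coe.mpr (hle i)) (Finset.le_max h)⟩

end Last

theorem min_localizedSupport_iff (T : Finset (Fin n)) {A : Finset (Fin n)}
    (hA : A ≠ Finset.univ) :
    (Finset.univ : Finset {i : Fin n // i ∉ A}).min < (localizedSupport T A).min ↔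
      ∀ t : Fin n, (∀ i ≤ t, i ∈ T) → t ∈ A := by
  have hne : (Finset.univ : Finset {i : Fin n // i ∉ A}).Nonempty := by
    by_contra h
    refine hA (Finset.eq_univ_iff_forall.mpr fun i => ?_)
    by_contra hi
    exact h ⟨⟨i, hi⟩, Finset.mem_univ _⟩
  obtain ⟨p, hp⟩ := Finset.min_of_nonempty hne
  have hle : ∀ i : {i : Fin n // i ∉ A}, p ≤ i := fun i =>
    Finset.min_le_of_eq (Finset.mem_univ i) hp
  have hlow : ∀ i : Fin n, i < p → i ∈ A := fun i hi => by
    by_contra h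
    exact absurd (hle ⟨i, h⟩) (not_le.mpr hi)
  have hmem : p ∈ localizedSupport T A ↔ ∀ i ≤ (p : Fin n), i ∈ T := by
    rw [mem_localizedSupport, excess_lt_excess_succ_iff]
    have hαj : ∀ j ≤ ((p : Fin n) : ℕ), headCount A j = j := fun j hj =>
      (headCount_eq_iff A j (by omega)).mpr fun i hi => hlow i (by rw [Fin.lt_def]; omega)
    have hα := headCount_succ A (p : Fin n)
    rw [if_neg p.2, hαj _ le_rfl] at hα
    have h1 := headCount_eq_iff T ((p : Fin n) + 1) (p : Fin n).2
    have h2 := headCount_le T ((p : Fin n) + 1) (p : Fin n).2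
    have h3 : (∀ i : Fin n, (i : ℕ) < (p : Fin n) + 1 → i ∈ T) ↔ ∀ i ≤ (p : Fin n), i ∈ T :=
      forall_congr' fun i => by rw [Nat.lt_succ_iff, Fin.le_def]
    rw [← h3, ← h1]
    constructor
    · intro h
      have := h 0 (Nat.zero_le _)
      rw [headCount_zero, headCount_zero] at this
      omega
    · intro h j hj
      have h4 := hαj j hj
      have h5 := headCount_le T j (by omega)
      omega
  have hlt : (Finset.univ : Finset {i : Fin n // i ∉ A}).min < (localizedSupport T A).min ↔
      p ∉ localizedSupport T A := by
    rw [hp]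
    constructor
    · intro h hpU
      exact absurd (Finset.min_le hpU) (not_le.mpr h)
    · intro h
      rw [Finset.min_eq_inf_withTop, Finset.lt_inf_iff (WithTop.coe_lt_top p)]
      intro i hi
      refine WithTop.coe_lt_coe.mpr (lt_of_le_of_ne (hle i) ?_)
      rintro rfl
      exact h hi
  rw [hlt, hmem]
  constructor
  · intro h t ht
    by_contra htA
    exact h fun i hi => ht i (hi.trans (hle ⟨t, htA⟩))
  · intro h hp'
    exact p.2 (h p hp')

end Entries

end SquarefreeBorel

theorem theorem3p2 {K : Type*} [Field K] {n : ℕ}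
    (I : Ideal (MvPolynomial (Fin n) K)) (u : Fin n →₀ ℕ)
    (hI : SquarefreeBorel.IsBorelGenerator 1 I u)
    (hu : ∀ i : Fin n, (i : ℕ) = 0 → u ≠ Finsupp.single i 1)
    (A : Finset (Fin n)) (hA : A ≠ Finset.univ) :
    (∃! uA : {i : Fin n // i ∉ A} →₀ ℕ,
      SquarefreeBorel.IsBorelGenerator 1 (SquarefreeBorel.monomialLocalization I A) uA) ∧
    ∀ uA : {i : Fin n // i ∉ A} →₀ ℕ,
      SquarefreeBorel.IsBorelGenerator 1 (SquarefreeBorel.monomialLocalization I A) uA →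
      -- (a) iff (b)(i) and (b)(ii), unless `S_A = K[x_j]` and `u_A = x_j`
      ((¬ ∃ j, (∀ i : {i : Fin n // i ∉ A}, i = j) ∧ uA = Finsupp.single j 1) →
        (SquarefreeBorel.monomialPrime K A ∈ SquarefreeBorel.stableAss I ↔
          (Finset.univ : Finset {i : Fin n // i ∉ A}).min < uA.support.min ∧
          uA.support.max = (Finset.univ : Finset {i : Fin n // i ∉ A}).max)) ∧
      -- the exceptional case
      ((∃ j, (∀ i : {i : Fin n // i ∉ A}, i = j) ∧ uA = Finsupp.single j 1) →
        SquarefreeBorel.monomialPrime K A ∈ SquarefreeBorel.stableAss I) ∧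
      -- (b)(i) in terms of the indices
      ((Finset.univ : Finset {i : Fin n // i ∉ A}).min < uA.support.min ↔
        ∀ t ≤ SquarefreeBorel.numH u.support, SquarefreeBorel.entry A t = t) ∧
      -- (b)(ii) in terms of the indices
      (uA.support.max = (Finset.univ : Finset {i : Fin n // i ∉ A}).max ↔
        SquarefreeBorel.entry u.support (SquarefreeBorel.numG u.support A) =
          SquarefreeBorel.entry A (SquarefreeBorel.numF A + 1) - 1 ∧
        ∀ j < SquarefreeBorel.numF A,
          SquarefreeBorel.numL u.support A (SquarefreeBorel.numF A - j) <
            SquarefreeBorel.numG u.support A - j) := by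
  open SquarefreeBorel in
  obtain ⟨-, rfl⟩ := isBorelGenerator_iff.mp hI
  generalize u.support = T
  have hgen : ∀ uA : {i : Fin n // i ∉ A} →₀ ℕ,
      IsBorelGenerator 1 (monomialLocalization (borelIdeal K T) A) uA ↔
        uA = squarefreeVector (localizedSupport T A) := fun uA => by
    rw [monomialLocalization_borelIdeal, isBorelGenerator_borelIdeal_iff]
  refine ⟨⟨_, (hgen _).mpr rfl, fun y hy => (hgen y).mp hy⟩, fun uA huA => ?_⟩
  obtain rfl := (hgen uA).mp huA
  obtain ⟨q, hqA, hq⟩ : ∃ q, q ∉ A ∧ ∀ i, q < i → i ∈ A := by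
    have hne : Aᶜ.Nonempty := by
      rwa [Finset.nonempty_iff_ne_empty, Ne, Finset.compl_eq_empty_iff]
    refine ⟨Aᶜ.max' hne, Finset.mem_compl.mp (Aᶜ.max'_mem hne), fun i hi => ?_⟩
    by_contra hiA
    exact absurd (Aᶜ.le_max' i (Finset.mem_compl.mpr hiA)) (not_le.mpr hi)
  have hle : ∀ i ∉ A, i ≤ q := fun i hi => not_lt.mp fun h => hi (hq i h)
  rw [support_squarefreeVector, min_localizedSupport_iff T hA, max_localizedSupport_iff T hqA hq,
    monomialPrime_mem_stableAss_iff hqA hq, forall_entry_eq_iff, index_condition_iff T hqA hq]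
  refine ⟨fun hnot => ⟨fun ⟨h2, h1⟩ => ⟨fun t ht => ?_, h2⟩, fun ⟨h1, h2⟩ => ⟨h2, fun p hp _ => ?_⟩⟩,
    ?_, Iff.rfl, Iff.rfl⟩
  · by_contra htA
    have hns : ∀ p ∉ A, p < q → ¬ p ≤ t := fun p hp hpq hpt => by
      obtain ⟨i, hi, hiT⟩ := h1 p hp hpq
      exact hiT (ht i (hi.trans hpt))
    have htq : t = q := by
      by_contra hne
      exact hns t htA (lt_of_le_of_ne (hle t htA) hne) le_rfl
    have hall : ∀ i : {i : Fin n // i ∉ A}, i = ⟨q, hqA⟩ := fun i => by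
      by_contra hne
      have hiq : (i : Fin n) < q := lt_of_le_of_ne (hle i i.2) fun h => hne (Subtype.ext h)
      exact hns i i.2 hiq (htq ▸ hiq.le)
    -- then `q` is the only index outside `A` and the localized generator is `x_q`
    refine hnot ⟨⟨q, hqA⟩, hall, ?_⟩
    have hmem : (⟨q, hqA⟩ : {i : Fin n // i ∉ A}) ∈ localizedSupport T A :=
      mem_localizedSupport.mpr ((excess_lt_excess_succ_iff T A q).mpr h2)
    ext i
    rw [hall i, squarefreeVector_apply, if_pos hmem, Finsupp.single_eq_same]
  · by_contra! hT
    exact hp (h1 p hT)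
  · rintro ⟨j, hj, huj⟩
    have hjq := hj ⟨q, hqA⟩
    subst hjq
    have hmem : (⟨q, hqA⟩ : {i : Fin n // i ∉ A}) ∈ localizedSupport T A := by
      rw [← support_squarefreeVector (localizedSupport T A), huj, Finsupp.mem_support_iff,
        Finsupp.single_eq_same]
      exact one_ne_zero
    exact ⟨(excess_lt_excess_succ_iff T A q).mp (mem_localizedSupport.mp hmem),
      fun p hp hpq => absurd (congrArg Subtype.val (hj ⟨p, hp⟩)) hpq.ne⟩
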